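/- Let $k$ be a field and let $A$ be a finite-dimensional elementary $k$-algebra, i.e. $A/\operatorname{rad}A$ is isomorphic as a $k$-algebra to a finite product of copies of $k$. Assume that $A$ has finite global dimension, and let $\{e_1,\dots,e_n\}$ be a complete set of orthogonal primitive idempotents of $A$. The Cartan matrix of $A$ is $C_A=(c_{ij})\in\mathbb{Z}^{n\times n}$ with $c_{ij}=\dim_k e_jAe_i$; it is invertible over $\mathbb{Z}$. Write $C_A^{-T}$ for $(C_A^{-1})^T$. For an endomorphism $\phi$ of a finite-dimensional right $A$-module $M$, let $\operatorname{tv}\phi\in k^n$ be the column vector with entries $\operatorname{tr}(\phi|_{Me_i})$; for an endomorphism $\psi$ of a finite-dimensional left $A$-module $N$, let $\operatorname{tv}\psi$ be the row vector with entries $\operatorname{tr}(\psi|_{e_iN})$; for an endomorphism $\phi$ of a finite-dimensional $A$-bimodule $M$ (on which $k$ acts centrally), let $\operatorname{tm}\phi\in k^{n\times n}$ be the matrix with $(i,j)$ entry $\operatorname{tr}(\phi|_{e_jMe_i})$. Let $A^e=A^{\mathrm{op}}\otimes_k A$, $HH^l(A,M)=\operatorname{Ext}^l_{A^e}(A,M)$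 and $HH_l(A,M)=\operatorname{Tor}_l^{A^e}(A,M)$. Then the following four (equivalent) statements hold; all the $\operatorname{Ext}$, $\operatorname{Tor}$, $HH$ spaces occurring in them are finite-dimensional over $k$ and vanish for all large $l$, and the formulas are identities in $k$. (1) For all endomorphisms $\phi$ of a finite-dimensional right $A$-module $M$ and $\psi$ of a finite-dimensional right $A$-module $N$, $$\sum_{l\ge 0}(-1)^l\operatorname{tr}\bigl(\operatorname{Ext}_A^l(\phi,\psi)\bigr)=(\operatorname{tv}\phi)^T\, C_A^{-T}\,\operatorname{tv}\psi .$$ (2) For all endomorphisms $\phi$ of a finite-dimensional right $A$-module $M$ and $\psi$ of a finite-dimensional left $A$-module $N$, $$\sum_{l\ge 0}(-1)^l\operatorname{tr}\bigl(\operatorname{Tor}^A_l(\phi,\psi)\bigr)=\operatorname{tv}\psi\; C_A^{-1}\,\operatorname{tv}\phi .$$ (3) For every endomorphism $\phi$ of a finite-dimensional $A$-bimodule $M$, $$\sum_{l\ge 0}(-1)^l\operatorname{tr}\bigl(HH^l(A,\phi)\bigr)=\operatorname{tr}\bigl(C_A^{-T}\cdot\operatorname{tm}\phi\bigr).$$ (4)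 For every endomorphism $\phi$ of a finite-dimensional $A$-bimodule $M$, $$\sum_{l\ge 0}(-1)^l\operatorname{tr}\bigl(HH_l(A,\phi)\bigr)=\operatorname{tr}\bigl(C_A^{-1}\cdot\operatorname{tm}\phi\bigr).$$ -/

import Mathlib

open CategoryTheory MulOpposite
open scoped TensorProduct Matrix ModuleCat.Algebra

universe u

noncomputable section

namespace Lefschetz

/-! ### Elementary algebras, global dimension, primitive idempotents -/

/-- A `k`-algebra is elementary if its quotient by the Jacobson radical is isomorphic, as a
`k`-algebra, to a finite direct product of copies of `k`. -/
def IsElementary (k A : Type u) [Field k] [Ring A] [Algebra k A] : Prop :=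
  ∃ m : ℕ, Nonempty ((A ⧸ Ring.jacobson A) ≃ₐ[k] (Fin m → k))

/-- Finite (right) global dimension: the projective dimensions of all right modules are
bounded by a common natural number. Right `A`-modules are modules over `Aᵐᵒᵖ`. -/
def HasFiniteGlobalDimension (A : Type u) [Ring A] : Prop :=
  ∃ d : ℕ, ∀ M : ModuleCat.{u} Aᵐᵒᵖ, HasProjectiveDimensionLE M d

/-- A primitive idempotent: a nonzero idempotent that is not the sum of two nonzero
orthogonal idempotents. -/
def IsPrimitiveIdempotent {A : Type u} [Ring A] (e : A) : Prop :=
  IsIdempotentElem e ∧ e ≠ 0 ∧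
    ∀ f g : A, IsIdempotentElem f → IsIdempotentElem g → f * g = 0 → g * f = 0 →
      e = f + g → f = 0 ∨ g = 0

/-- A (finite) complete set of orthogonal primitive idempotents of `A`. -/
structure IsCompletePrimitive {A : Type u} [Ring A] {n : ℕ} (e : Fin n → A) : Prop where
  complete : CompleteOrthogonalIdempotents e
  primitive : ∀ i, IsPrimitiveIdempotent (e i)

/-! ### Trace vectors -/

section OneSided

variable (k : Type u) [Field k] {R : Type u} [Ring R] [Algebra k R]

/-- For a left `R`-module `M` and `e : R`, the subspace `e M`. For a right `A`-module `M`,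
i.e. `R = Aᵐᵒᵖ`, the subspace for `op e` is `M e`. -/
def piece (M : Type u) [AddCommGroup M] [Module k M] [Module R M] [IsScalarTower k R M]
    (e : R) : Submodule k M :=
  LinearMap.range (Algebra.lsmul k k M e)

/-- The restriction of a module endomorphism `φ` of `M` to `e M`. -/
def pieceEnd {M : Type u} [AddCommGroup M] [Module k M] [Module R M] [IsScalarTower k R M]
    (φ : M →ₗ[R] M) (e : R) : piece k M e →ₗ[k] piece k M e :=
  (φ.restrictScalars k).restrict (by
    rintro _ ⟨x, rfl⟩
    exact ⟨φ x, by simp⟩)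

end OneSided

section TraceVectors

variable (k : Type u) [Field k] {A : Type u} [Ring A] [Algebra k A] {n : ℕ} (e : Fin n → A)
  {M : Type u} [AddCommGroup M] [Module k M]

/-- The trace vector of an endomorphism `φ` of a right `A`-module: the traces of `φ` on the
`M eᵢ`. -/
def tvRight [Module Aᵐᵒᵖ M] [IsScalarTower k Aᵐᵒᵖ M] (φ : M →ₗ[Aᵐᵒᵖ] M) : Fin n → k :=
  fun i => LinearMap.trace k (piece k M (op (e i))) (pieceEnd k φ (op (e i)))

/-- The trace vector of an endomorphism `ψ` of a left `A`-module: the traces of `ψ` on the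
`eᵢ M`. -/
def tvLeft [Module A M] [IsScalarTower k A M] (ψ : M →ₗ[A] M) : Fin n → k :=
  fun i => LinearMap.trace k (piece k M (e i)) (pieceEnd k ψ (e i))

end TraceVectors

/-! ### Bimodules: pieces, endomorphisms, trace matrices, the Cartan matrix

An `A`-bimodule is a `k`-vector space `M` with commuting left and right `A`-module structures,
both compatible with the one of `k`. -/

section Bimodules

variable (k : Type u) [Field k] (A : Type u) [Ring A] [Algebra k A]
  (M : Type u) [AddCommGroup M] [Module k M] [Module A M] [Module Aᵐᵒᵖ M]
  [IsScalarTower k A M] [IsScalarTower k Aᵐᵒᵖ M] [SMulCommClass A Aᵐᵒᵖ M]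

/-- Endomorphisms of an `A`-bimodule. -/
structure BimodEnd extends M →ₗ[k] M where
  map_left : ∀ (a : A) (x : M), toFun (a • x) = a • toFun x
  map_right : ∀ (a : A) (x : M), toFun (op a • x) = op a • toFun x

variable {A}

/-- The subspace `f M e` of an `A`-bimodule. -/
def biPiece (f e : A) : Submodule k M :=
  LinearMap.range (Algebra.lsmul k k M f ∘ₗ Algebra.lsmul k k M (op e))

variable {M}

/-- The restriction of a bimodule endomorphism `φ` of `M` to `f M e`. -/
def biPieceEnd (φ : BimodEnd k A M) (f e : A) : biPiece k M f e →ₗ[k] biPiece k M f e :=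
  φ.toLinearMap.restrict (by
    rintro _ ⟨x, rfl⟩
    refine ⟨φ.toLinearMap x, ?_⟩
    have h1 := φ.map_left f (op e • x)
    have h2 := φ.map_right e x
    simp only [AddHom.toFun_eq_coe, LinearMap.coe_toAddHom] at h1 h2
    simp [h1, h2])

variable {n : ℕ} (e : Fin n → A)

/-- The trace matrix of a bimodule endomorphism: its `(i, j)` entry is the trace on
`eⱼ M eᵢ`. -/
def traceMatrix (φ : BimodEnd k A M) : Matrix (Fin n) (Fin n) k :=
  Matrix.of fun i j => LinearMap.trace k (biPiece k M (e j) (e i)) (biPieceEnd k φ (e j) (e i))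

/-- The Cartan matrix of `A`: its `(i, j)` entry is the dimension of `eⱼ A eᵢ`. -/
def cartanMatrix : Matrix (Fin n) (Fin n) ℤ :=
  Matrix.of fun i j => (Module.finrank k (biPiece k A (e j) (e i)) : ℤ)

end Bimodules

/-- The inverse `C⁻¹` of an integer matrix `C` (invertible over the integers), read in `k`. -/
def invIn (k : Type u) [Field k] {n : ℕ} (C : Matrix (Fin n) (Fin n) ℤ) :
    Matrix (Fin n) (Fin n) k :=
  C⁻¹.map (Int.cast : ℤ → k)

/-! ### The enveloping algebra and its modules -/

/-- The enveloping algebra `Aᵒᵖ ⊗ A`. -/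
abbrev Env (k A : Type u) [Field k] [Ring A] [Algebra k A] : Type u := Aᵐᵒᵖ ⊗[k] A

section Enveloping

variable (k : Type u) [Field k] (A : Type u) [Ring A] [Algebra k A]
  (M : Type u) [AddCommGroup M] [Module k M] [Module A M] [Module Aᵐᵒᵖ M]
  [IsScalarTower k A M] [IsScalarTower k Aᵐᵒᵖ M] [SMulCommClass A Aᵐᵒᵖ M]

/-- The left action `(a ⊗ b) x = b x a` of `Aᵒᵖ ⊗ A` on a bimodule. -/
def leftEnvHom : Env k A →ₐ[k] Module.End k M :=
  Algebra.TensorProduct.lift (Algebra.lsmul k k M) (Algebra.lsmul k k M) (fun a b => by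
    ext x
    exact (smul_comm b a x).symm)

/-- The right action `x (a ⊗ b) = a x b` of `Aᵒᵖ ⊗ A` on a bimodule. -/
def rightEnvHom : (Env k A)ᵐᵒᵖ →ₐ[k] Module.End k M :=
  AlgHom.opComm (Algebra.TensorProduct.lift
    (AlgHom.op (Algebra.lsmul k k M : A →ₐ[k] Module.End k M))
    (AlgHom.opComm.symm (Algebra.lsmul k k M : Aᵐᵒᵖ →ₐ[k] Module.End k M)) (fun a b => by
      apply MulOpposite.unop_injective
      ext x
      exact (smul_comm (unop a) (op b) x).symm))

theorem leftEnvHom_tmul (a : Aᵐᵒᵖ) (b : A) (x : M) :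
    leftEnvHom k A M (a ⊗ₜ b) x = a • b • x := by
  have h : leftEnvHom k A M (a ⊗ₜ b) =
      (Algebra.lsmul k k M a : Module.End k M) * Algebra.lsmul k k M b :=
    Algebra.TensorProduct.lift_tmul _ _ _ a b
  rw [h]
  rfl

theorem rightEnvHom_tmul (a : Aᵐᵒᵖ) (b : A) (x : M) :
    rightEnvHom k A M (op (a ⊗ₜ b)) x = op b • unop a • x := by
  simp [rightEnvHom, AlgHom.opComm]

/-- A bimodule as a left module over the enveloping algebra. -/
def bimodLeft : ModuleCat.{u} (Env k A) :=
  letI : Module (Env k A) M := Module.compHom M (leftEnvHom k A M).toRingHom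
  ModuleCat.of (Env k A) M

/-- A bimodule as a right module over the enveloping algebra. -/
def bimodRight : ModuleCat.{u} (Env k A)ᵐᵒᵖ :=
  letI : Module (Env k A)ᵐᵒᵖ M := Module.compHom M (rightEnvHom k A M).toRingHom
  ModuleCat.of (Env k A)ᵐᵒᵖ M

variable {k A M}

theorem BimodEnd.map_leftEnv (φ : BimodEnd k A M) (r : Env k A) (x : M) :
    φ.toLinearMap (leftEnvHom k A M r x) = leftEnvHom k A M r (φ.toLinearMap x) := by
  induction r using TensorProduct.induction_on with
  | zero => simp
  | add r s hr hs => simp [hr, hs]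
  | tmul a b =>
    rw [leftEnvHom_tmul, leftEnvHom_tmul]
    have h1 := φ.map_left b x
    have h2 := φ.map_right (unop a) (b • x)
    simp only [AddHom.toFun_eq_coe, LinearMap.coe_toAddHom, op_unop] at h1 h2
    rw [h2, h1]

theorem BimodEnd.map_rightEnv (φ : BimodEnd k A M) (r : Env k A) (x : M) :
    φ.toLinearMap (rightEnvHom k A M (op r) x) =
      rightEnvHom k A M (op r) (φ.toLinearMap x) := by
  induction r using TensorProduct.induction_on with
  | zero => simp
  | add r s hr hs => simp [hr, hs]
  | tmul a b =>
    rw [rightEnvHom_tmul, rightEnvHom_tmul]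
    have h1 := φ.map_left (unop a) x
    have h2 := φ.map_right b (unop a • x)
    simp only [AddHom.toFun_eq_coe, LinearMap.coe_toAddHom] at h1 h2
    rw [h2, h1]

/-- A bimodule endomorphism as an endomorphism of left modules over the enveloping algebra. -/
def BimodEnd.left (φ : BimodEnd k A M) : bimodLeft k A M ⟶ bimodLeft k A M :=
  letI : Module (Env k A) M := Module.compHom M (leftEnvHom k A M).toRingHom
  ModuleCat.ofHom
    { toFun := φ.toLinearMap
      map_add' := φ.toLinearMap.map_add
      map_smul' := fun r x => φ.map_leftEnv r x }

/-- A bimodule endomorphism as an endomorphism of right modules over the enveloping algebra. -/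
def BimodEnd.right (φ : BimodEnd k A M) : bimodRight k A M ⟶ bimodRight k A M :=
  letI : Module (Env k A)ᵐᵒᵖ M := Module.compHom M (rightEnvHom k A M).toRingHom
  ModuleCat.ofHom
    { toFun := φ.toLinearMap
      map_add' := φ.toLinearMap.map_add
      map_smul' := fun r x => φ.map_rightEnv (unop r) x }

end Enveloping

/-! ### Tensor products over a noncommutative algebra -/

section Tensor

variable (k : Type u) [Field k] (R : Type u) [Ring R] [Algebra k R]

/-- The subspace of `M ⊗ₖ N` spanned by the `m r ⊗ n - m ⊗ r n`. -/
def balancing (M : ModuleCat.{u} Rᵐᵒᵖ) (N : ModuleCat.{u} R) : Submodule k (M ⊗[k] N) :=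
  Submodule.span k
    {t | ∃ (m : M) (r : R) (n : N), t = (op r • m) ⊗ₜ[k] n - m ⊗ₜ[k] (r • n)}

/-- The tensor product `M ⊗_R N` of a right and a left `R`-module. -/
abbrev balancedTensor (M : ModuleCat.{u} Rᵐᵒᵖ) (N : ModuleCat.{u} R) : Type u :=
  (M ⊗[k] N) ⧸ balancing k R M N

variable {R}

/-- The map `f ⊗ g : M ⊗_R N → M' ⊗_R N'`. -/
def balancedMap {M M' : ModuleCat.{u} Rᵐᵒᵖ} {N N' : ModuleCat.{u} R} (f : M ⟶ M')
    (g : N ⟶ N') : balancedTensor k R M N →ₗ[k] balancedTensor k R M' N' :=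
  Submodule.mapQ _ _ (TensorProduct.map (f.hom.restrictScalars k) (g.hom.restrictScalars k)) (by
    rw [balancing, Submodule.span_le]
    rintro _ ⟨m, r, n, rfl⟩
    exact Submodule.subset_span ⟨f.hom m, r, g.hom n, by simp⟩)

theorem balancedMap_mk {M M' : ModuleCat.{u} Rᵐᵒᵖ} {N N' : ModuleCat.{u} R} (f : M ⟶ M')
    (g : N ⟶ N') (m : M) (n : N) :
    balancedMap k f g (Submodule.Quotient.mk (m ⊗ₜ[k] n)) =
      Submodule.Quotient.mk (f.hom m ⊗ₜ[k] g.hom n) := rfl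

theorem balanced_ext {M : ModuleCat.{u} Rᵐᵒᵖ} {N : ModuleCat.{u} R} {V : Type u}
    [AddCommGroup V] [Module k V] {f g : balancedTensor k R M N →ₗ[k] V}
    (h : ∀ (m : M) (n : N), f (Submodule.Quotient.mk (m ⊗ₜ[k] n)) =
      g (Submodule.Quotient.mk (m ⊗ₜ[k] n))) : f = g := by
  apply Submodule.linearMap_qext
  apply TensorProduct.ext'
  exact h

/-- The functor `- ⊗_R N` from right `R`-modules to `k`-vector spaces. -/
def tensorRight (N : ModuleCat.{u} R) : ModuleCat.{u} Rᵐᵒᵖ ⥤ ModuleCat.{u} k where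
  obj M := ModuleCat.of k (balancedTensor k R M N)
  map f := ModuleCat.ofHom (balancedMap k f (𝟙 N))
  map_id M := by
    apply ModuleCat.hom_ext
    apply balanced_ext
    intro m n
    rfl
  map_comp f g := by
    apply ModuleCat.hom_ext
    apply balanced_ext
    intro m n
    rfl

instance (N : ModuleCat.{u} R) : (tensorRight k N).Additive where
  map_add {M M'} {f g} := by
    apply ModuleCat.hom_ext
    apply balanced_ext
    intro m n
    change (Submodule.Quotient.mk ((f.hom m + g.hom m) ⊗ₜ[k] n) : balancedTensor k R M' N) = _
    rw [TensorProduct.add_tmul]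
    rfl

/-- The natural transformation `- ⊗_R g`. -/
def tensorRightMap {N N' : ModuleCat.{u} R} (g : N ⟶ N') :
    tensorRight k N ⟶ tensorRight k N' where
  app M := ModuleCat.ofHom (balancedMap k (𝟙 M) g)
  naturality M M' f := by
    apply ModuleCat.hom_ext
    apply balanced_ext
    intro m n
    rfl

end Tensor

/-! ### Ext, Tor, Hochschild (co)homology and the operators induced on them -/

section ExtTor

variable (k : Type u) [Field k] {R : Type u} [Ring R] [Algebra k R]

/-- `Ext^l_R(M, N)` for right `R`-modules, as a `k`-vector space. -/
abbrev ExtR (l : ℕ) (M N : ModuleCat.{u} Rᵐᵒᵖ) : ModuleCat.{u} k :=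
  ((_root_.Ext k (ModuleCat.{u} Rᵐᵒᵖ) l).obj (Opposite.op M)).obj N

/-- The operator `Ext^l_R(φ, ψ)` on `Ext^l_R(M, N)`. -/
def extEnd (l : ℕ) {M N : ModuleCat.{u} Rᵐᵒᵖ} (φ : M ⟶ M) (ψ : N ⟶ N) :
    ExtR k l M N ⟶ ExtR k l M N :=
  ((_root_.Ext k (ModuleCat.{u} Rᵐᵒᵖ) l).map φ.op).app N ≫
    ((_root_.Ext k (ModuleCat.{u} Rᵐᵒᵖ) l).obj (Opposite.op M)).map ψ

/-- `Tor_l^R(M, N)` for a right module `M` and a left module `N`, as a `k`-vector space: the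
left derived functors of `- ⊗_R N`. -/
abbrev TorR (l : ℕ) (M : ModuleCat.{u} Rᵐᵒᵖ) (N : ModuleCat.{u} R) : ModuleCat.{u} k :=
  ((tensorRight k N).leftDerived l).obj M

/-- The operator `Tor_l^R(φ, ψ)` on `Tor_l^R(M, N)`. -/
def torEnd (l : ℕ) {M : ModuleCat.{u} Rᵐᵒᵖ} {N : ModuleCat.{u} R} (φ : M ⟶ M) (ψ : N ⟶ N) :
    TorR k l M N ⟶ TorR k l M N :=
  ((tensorRight k N).leftDerived l).map φ ≫ (NatTrans.leftDerived (tensorRightMap k ψ) l).app M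

variable {k} {A : Type u} [Ring A] [Algebra k A]
  {M : Type u} [AddCommGroup M] [Module k M] [Module A M] [Module Aᵐᵒᵖ M]
  [IsScalarTower k A M] [IsScalarTower k Aᵐᵒᵖ M] [SMulCommClass A Aᵐᵒᵖ M]

/-- The operator `HH^l(A, φ)` on `HH^l(A, M) = Ext^l(A, M)`, the Ext group being taken over the
enveloping algebra. -/
def hochschildCohomologyEnd (φ : BimodEnd k A M) (l : ℕ) :
    ExtR k l (bimodRight k A A) (bimodRight k A M) ⟶
      ExtR k l (bimodRight k A A) (bimodRight k A M) :=
  extEnd k l (𝟙 (bimodRight k A A)) φ.right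

/-- The operator `HH_l(A, φ)` on `HH_l(A, M) = Tor_l(A, M)`, the Tor group being taken over the
enveloping algebra. -/
def hochschildHomologyEnd (φ : BimodEnd k A M) (l : ℕ) :
    TorR k l (bimodRight k A A) (bimodLeft k A M) ⟶
      TorR k l (bimodRight k A A) (bimodLeft k A M) :=
  torEnd k l (𝟙 (bimodRight k A A)) φ.left

end ExtTor

/-- The graded space `V` (in degrees `0, 1, 2, …`) is finite dimensional in each degree, is zero in
all large degrees, and the graded operator `f` on it has super trace `∑ₗ (-1)ˡ tr fₗ = t`. -/
def HasSuperTrace {k : Type u} [Field k] {V : ℕ → ModuleCat.{u} k} (f : ∀ l, V l ⟶ V l)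
    (t : k) : Prop :=
  (∀ l, Module.Finite k (V l)) ∧
    ∃ d : ℕ, (∀ l, d ≤ l → Subsingleton (V l)) ∧
      ∑ l ∈ Finset.range d, (-1 : k) ^ l * LinearMap.trace k (V l) (f l).hom = t

end Lefschetz

end

noncomputable section

namespace Lefschetz

/-! ### Abstract additive traces -/

open Limits

/-! All four formulas are instances of one trace formula for the left derived functors of an
additive functor `F` on `R`-modules with an endotransformation `α` (`derived_trace_formula`). Take a
bounded resolution `P` of `M` by finitely generated projectives and lift `φ` to `β : P ⟶ P`. By the
Hopf trace formula the super trace on the derived functors is the alternating sum of the traces of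
`F(β_l)` followed by `α`. On a finitely generated projective such a trace depends only on the
regular module (Hattori–Stallings): it is a sum of values `g r = tr (F(· r) ≫ α)`.

In every case needed, the linear form `g` vanishes on nilpotent elements. Since `A` is elementary,
the idempotents span the algebra modulo nilpotents, so `g` is determined by its values on them. The
forms `r ↦ tr (x ↦ e_j x r)` also vanish on nilpotents, and their values on the idempotents are
Cartan numbers read in `k`. Inverting that matrix writes `g` in terms of these forms. A second use
of Hopf, for the quasi-isomorphism from `P` to `M`, turns the alternating sum of `tr (e_j β_l)` into
`tr (e_j φ)`. The result is `∑ g(e_i) (C⁻¹)_{ij} tr (e_j φ)`.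

For Ext and Tor the formula is used over `Aᵐᵒᵖ`, with `F = Hom(-, N)` (valued in an opposite
category) and `F = - ⊗ N`; in both, `F` of the regular module is `N`, and `g r` is the trace of `r
ψ`. For Hochschild theory it is used over the opposite of the enveloping algebra with `φ = id_A`;
the matrix to invert is a Kronecker product of two Cartan matrices, and one factor cancels against
the trace vector of `id_A`.

Two inputs remain. The Cartan matrix is invertible over `ℤ` because the dimension vectors of the
simple modules form the standard basis, and finite projective resolutions put them in the span of
its columns (`isUnit_cartanMatrix`). Finite-dimensional bimodules have finite projective dimension
(`hasFiniteResolution_env`): filtering by powers of the radical `J` reduces to bimodules killed by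
`J` on the left, which are retracts of sums of outer products `S_i ⊗ Y`. These are resolved factor
by factor, the left factor by duality from right modules. -/

/-- A `k`-valued trace function on the endomorphisms of an abelian category which is cyclic, and
additive on short exact sequences of objects satisfying a finiteness condition. -/
structure AdditiveTrace (k : Type*) [Field k] (D : Type*) [Category* D] [Abelian D] where
  /-- the finiteness condition -/
  fin : D → Prop
  /-- the trace -/
  tr : ∀ {X : D}, (X ⟶ X) → k
  fin_iff : ∀ {S : ShortComplex D}, S.ShortExact → (fin S.X₂ ↔ fin S.X₁ ∧ fin S.X₃)
  tr_shortExact : ∀ {S : ShortComplex D}, S.ShortExact → fin S.X₂ → ∀ f : S ⟶ S,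
    tr f.τ₂ = tr f.τ₁ + tr f.τ₃
  tr_add : ∀ {X : D} (f g : X ⟶ X), tr (f + g) = tr f + tr g
  tr_comm : ∀ {X Y : D}, fin X → fin Y → ∀ (f : X ⟶ Y) (g : Y ⟶ X), tr (f ≫ g) = tr (g ≫ f)

namespace AdditiveTrace

variable {k : Type*} [Field k] {D : Type*} [Category* D] [Abelian D] (t : AdditiveTrace k D)

theorem tr_zero (X : D) : t.tr (0 : X ⟶ X) = 0 := by
  have h := t.tr_add (0 : X ⟶ X) 0
  rw [add_zero] at h
  exact left_eq_add.mp h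

theorem tr_sum {X : D} {ι : Type*} (s : Finset ι) (f : ι → (X ⟶ X)) :
    t.tr (∑ a ∈ s, f a) = ∑ a ∈ s, t.tr (f a) := by
  classical
  induction s using Finset.induction_on with
  | empty => simp [tr_zero]
  | insert a s ha ih => rw [Finset.sum_insert ha, Finset.sum_insert ha, t.tr_add, ih]

theorem tr_of_isZero {X : D} (hX : IsZero X) (f : X ⟶ X) : t.tr f = 0 := by
  rw [hX.eq_of_src f 0, t.tr_zero]

theorem fin_X₁ {S : ShortComplex D} (hS : S.ShortExact) (h : t.fin S.X₂) : t.fin S.X₁ :=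
  ((t.fin_iff hS).1 h).1

theorem fin_X₃ {S : ShortComplex D} (hS : S.ShortExact) (h : t.fin S.X₂) : t.fin S.X₃ :=
  ((t.fin_iff hS).1 h).2

theorem fin_of_mono {X Y : D} (i : X ⟶ Y) [Mono i] (h : t.fin Y) : t.fin X :=
  t.fin_X₁ (S := ShortComplex.mk i (cokernel.π i) (by simp))
    { exact := ShortComplex.exact_cokernel i } h

theorem fin_of_epi {X Y : D} (p : X ⟶ Y) [Epi p] (h : t.fin X) : t.fin Y :=
  t.fin_X₃ (S := ShortComplex.mk (kernel.ι p) p (by simp))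
    { exact := ShortComplex.exact_kernel p } h

theorem fin_of_isZero {X Y : D} (hX : IsZero X) (h : t.fin Y) : t.fin X := by
  have : Mono (0 : X ⟶ Y) := ⟨fun _ _ _ => hX.eq_of_tgt _ _⟩
  exact t.fin_of_mono (0 : X ⟶ Y) h

theorem tr_conj {X Y : D} (e : X ≅ Y) (hX : t.fin X) (f : X ⟶ X) (g : Y ⟶ Y)
    (h : f ≫ e.hom = e.hom ≫ g) : t.tr f = t.tr g := by
  have hf : f = e.hom ≫ (g ≫ e.inv) := by rw [← Category.assoc, ← h]; simp
  rw [hf, t.tr_comm hX (t.fin_of_epi e.hom hX)]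
  simp

/-! ### The Hopf trace formula for bounded complexes -/

section Hopf

variable (K : ChainComplex D ℕ) (f : K ⟶ K)

/-- The boundaries of a chain complex. -/
abbrev boundaries (K : ChainComplex D ℕ) (l : ℕ) : D := kernel (K.homologyπ l)

/-- The map induced on boundaries by a chain map. -/
abbrev boundariesMap (l : ℕ) : boundaries K l ⟶ boundaries K l :=
  kernel.map _ _ (HomologicalComplex.cyclesMap f l) (HomologicalComplex.homologyMap f l)
    (HomologicalComplex.homologyπ_naturality f l)

theorem shortExact_boundaries (l : ℕ) :
    (ShortComplex.mk (kernel.ι (K.homologyπ l)) (K.homologyπ l) (by simp)).ShortExact :=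
  { exact := ShortComplex.exact_kernel _ }

/-- The corestriction of the differential to the boundaries. -/
abbrev toBoundaries (l : ℕ) : K.X (l + 1) ⟶ boundaries K l :=
  kernel.lift _ (K.toCycles (l + 1) l) (by simp)

theorem exact_toCycles (l : ℕ) :
    (ShortComplex.mk (K.toCycles (l + 1) l) (K.homologyπ l) (by simp)).Exact :=
  ShortComplex.exact_of_g_is_cokernel _ (K.homologyIsCokernel (l + 1) l (by simp))

theorem epi_toBoundaries (l : ℕ) : Epi (toBoundaries K l) :=
  (ShortComplex.exact_iff_epi_kernel_lift _).1 (exact_toCycles K l)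

theorem shortExact_toBoundaries (l : ℕ) :
    (ShortComplex.mk (K.iCycles (l + 1)) (toBoundaries K l) (by
      rw [← cancel_mono (kernel.ι (K.homologyπ l)), ← cancel_mono (K.iCycles l)]
      simp)).ShortExact where
  epi_g := epi_toBoundaries K l
  exact := by
    apply ShortComplex.exact_of_f_is_kernel
    have hm := K.cyclesIsKernel (l + 1) l (by simp)
    refine KernelFork.IsLimit.ofι _ _ (fun {W} x hx => hm.lift (KernelFork.ofι x ?_))
      (fun {W} x hx => ?_) (fun {W} x hx m hm' => ?_)
    · have := hx =≫ (kernel.ι (K.homologyπ l) ≫ K.iCycles l)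
      simpa using this
    · exact hm.fac _ WalkingParallelPair.zero
    · rw [← cancel_mono (K.iCycles (l + 1)), hm']
      exact (hm.fac (KernelFork.ofι x _) WalkingParallelPair.zero).symm

variable {K}

/-- The cycles `Z_{l+1}` sit in `K_{l+1}` with quotient the boundaries `B_l`, and `B_{l+1}` sits in
`Z_{l+1}` with quotient the homology. Each boundary trace thus occurs in two consecutive degrees and
cancels in an alternating sum. -/
theorem tr_succ (hK : ∀ l, t.fin (K.X l)) (l : ℕ) :
    t.tr (f.f (l + 1)) = t.tr (HomologicalComplex.homologyMap f (l + 1)) +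
      t.tr (boundariesMap K f (l + 1)) + t.tr (boundariesMap K f l) := by
  have h1 := t.tr_shortExact (shortExact_toBoundaries K l) (hK _)
    { τ₁ := HomologicalComplex.cyclesMap f (l + 1)
      τ₂ := f.f (l + 1)
      τ₃ := boundariesMap K f l
      comm₁₂ := by simp
      comm₂₃ := by
        rw [← cancel_mono (kernel.ι (K.homologyπ l)), ← cancel_mono (K.iCycles l)]
        simp }
  have h2 := t.tr_shortExact (shortExact_boundaries K (l + 1)) (t.fin_of_mono (K.iCycles _) (hK _))
    { τ₁ := boundariesMap K f (l + 1)
      τ₂ := HomologicalComplex.cyclesMap f (l + 1)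
      τ₃ := HomologicalComplex.homologyMap f (l + 1)
      comm₁₂ := by simp
      comm₂₃ := by simp }
  dsimp only at h1 h2
  rw [h1, h2]
  ring

theorem tr_zero_degree (hK : ∀ l, t.fin (K.X l)) :
    t.tr (f.f 0) = t.tr (HomologicalComplex.homologyMap f 0) +
      t.tr (boundariesMap K f 0) := by
  have : IsIso (K.iCycles 0) := K.isIso_iCycles 0 0 (by simp) (by simp)
  have h1 := t.tr_conj (asIso (K.iCycles 0)) (t.fin_of_mono (K.iCycles _) (hK _))
    (HomologicalComplex.cyclesMap f 0) (f.f 0) (by simp)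
  have h2 := t.tr_shortExact (shortExact_boundaries K 0) (t.fin_of_mono (K.iCycles _) (hK _))
    { τ₁ := boundariesMap K f 0
      τ₂ := HomologicalComplex.cyclesMap f 0
      τ₃ := HomologicalComplex.homologyMap f 0
      comm₁₂ := by simp
      comm₂₃ := by simp }
  dsimp only at h2
  rw [← h1, h2]
  ring

theorem fin_homology (hK : ∀ l, t.fin (K.X l)) (l : ℕ) : t.fin (K.homology l) :=
  t.fin_of_epi (K.homologyπ l) (t.fin_of_mono (K.iCycles _) (hK _))

theorem isZero_homology (l : ℕ) (h : IsZero (K.X l)) : IsZero (K.homology l) :=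
  (h.of_mono (K.iCycles l)).of_epi (K.homologyπ l)

/-- The Hopf trace formula. -/
theorem hopf (hK : ∀ l, t.fin (K.X l)) (d : ℕ) (hd : IsZero (K.X d)) :
    ∑ l ∈ Finset.range d, (-1 : k) ^ l * t.tr (f.f l) =
      ∑ l ∈ Finset.range d, (-1 : k) ^ l * t.tr (HomologicalComplex.homologyMap f l) := by
  cases d with
  | zero => simp
  | succ d =>
    -- Truncated alternating sums differ by the one boundary term not yet cancelled. At the last
    -- step it vanishes, because `B_d` is a quotient of `K_{d+1} = 0`.
    have key : ∀ m : ℕ, ∑ l ∈ Finset.range (m + 1), (-1 : k) ^ l * t.tr (f.f l) =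
        ∑ l ∈ Finset.range (m + 1), (-1 : k) ^ l * t.tr (HomologicalComplex.homologyMap f l) +
          (-1) ^ m * t.tr (boundariesMap K f m) := by
      intro m
      induction m with
      | zero => simp [t.tr_zero_degree f hK]
      | succ m ih =>
        rw [Finset.sum_range_succ, ih, Finset.sum_range_succ _ (m + 1), t.tr_succ f hK]
        ring
    have := epi_toBoundaries K d
    rw [key, t.tr_of_isZero (hd.of_epi (toBoundaries K d))]
    simp

/-- Quasi-isomorphic bounded complexes have the same super trace. -/
theorem hopf_quasiIso {L : ChainComplex D ℕ} (g : L ⟶ L) (q : K ⟶ L) [QuasiIso q]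
    (h : f ≫ q = q ≫ g) (hK : ∀ l, t.fin (K.X l)) (hL : ∀ l, t.fin (L.X l)) (d : ℕ)
    (hd : IsZero (K.X d)) (hd' : IsZero (L.X d)) :
    ∑ l ∈ Finset.range d, (-1 : k) ^ l * t.tr (f.f l) =
      ∑ l ∈ Finset.range d, (-1 : k) ^ l * t.tr (g.f l) := by
  rw [t.hopf f hK d hd, t.hopf g hL d hd']
  refine Finset.sum_congr rfl fun l _ => ?_
  congr 1
  refine t.tr_conj (asIso (HomologicalComplex.homologyMap q l)) (t.fin_homology hK l) _ _ ?_
  simp only [asIso_hom, ← HomologicalComplex.homologyMap_comp, h]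

end Hopf

/-- An additive trace on the opposite category. -/
def op : AdditiveTrace k Dᵒᵖ where
  fin X := t.fin X.unop
  tr f := t.tr f.unop
  fin_iff {S} hS := by
    rw [and_comm]
    exact t.fin_iff hS.unop
  tr_shortExact {S} hS h f := by
    rw [add_comm]
    exact t.tr_shortExact hS.unop h (ShortComplex.unopMap f)
  tr_add f g := t.tr_add _ _
  tr_comm hX hY f g := t.tr_comm hX hY _ _

end AdditiveTrace

/-! ### Finite resolutions as bounded complexes -/

section FiniteResolutions

variable {C : Type*} [Category* C] [Abelian C]

/-- The objects with a finite resolution by objects satisfying `Pr`. -/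
inductive HasFiniteResolution (Pr : C → Prop) : C → Prop
  | base {M : C} (h : Pr M) : HasFiniteResolution Pr M
  | step {S : ShortComplex C} (hS : S.ShortExact) (h₂ : Pr S.X₂)
      (h₁ : HasFiniteResolution Pr S.X₁) : HasFiniteResolution Pr S.X₃

/-- A bounded resolution of `M`, as a complex with an augmentation. -/
structure AugmentedResolution (Pr : C → Prop) (M : C) where
  /-- the complex -/
  complex : ChainComplex C ℕ
  /-- the augmentation -/
  ε : complex.X 0 ⟶ M
  d_ε : complex.d 1 0 ≫ ε = 0
  epi_ε : Epi ε
  exact_zero : (ShortComplex.mk (complex.d 1 0) ε d_ε).Exact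
  exact_succ : ∀ l, (ShortComplex.mk (complex.d (l + 2) (l + 1)) (complex.d (l + 1) l)
    (complex.d_comp_d _ _ _)).Exact
  /-- the length -/
  length : ℕ
  isZero : ∀ l, length < l → IsZero (complex.X l)
  prop : ∀ l, l ≤ length → Pr (complex.X l)

namespace AugmentedResolution

variable {Pr : C → Prop}

/-- The resolution of an object satisfying `Pr` by itself. -/
def self {M : C} (h : Pr M) : AugmentedResolution Pr M where
  complex := (ChainComplex.single₀ C).obj M
  ε := 𝟙 M
  d_ε := zero_comp
  epi_ε := inferInstanceAs (Epi (𝟙 M))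
  exact_zero := by
    rw [ShortComplex.exact_iff_mono _ rfl]
    exact inferInstanceAs (Mono (𝟙 M))
  exact_succ l := ShortComplex.exact_of_isZero_X₂ _
    (HomologicalComplex.isZero_single_obj_X (ComplexShape.down ℕ) 0 M (l + 1) (by simp))
  length := 0
  isZero l hl := HomologicalComplex.isZero_single_obj_X _ _ _ _ (by omega)
  prop l hl := by
    obtain rfl : l = 0 := by omega
    exact h

/-- Splicing a resolution of a kernel. -/
def splice {S : ShortComplex C} (hS : S.ShortExact) (h₂ : Pr S.X₂)
    (Q : AugmentedResolution Pr S.X₁) : AugmentedResolution Pr S.X₃ where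
  complex := Q.complex.augment (Q.ε ≫ S.f) (by rw [← Category.assoc, Q.d_ε, zero_comp])
  ε := S.g
  d_ε := (Category.assoc Q.ε S.f S.g).trans (by rw [S.zero]; exact comp_zero)
  epi_ε := hS.epi_g
  exact_zero := by
    have := Q.epi_ε
    let φ : ShortComplex.mk (Q.ε ≫ S.f) S.g (by simp) ⟶ S :=
      { τ₁ := Q.ε, τ₂ := 𝟙 _, τ₃ := 𝟙 _ }
    exact (ShortComplex.exact_iff_of_epi_of_isIso_of_mono φ).2 hS.exact
  exact_succ l := by
    cases l with
    | zero =>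
      have := hS.mono_f
      let φ : ShortComplex.mk (Q.complex.d 1 0) Q.ε Q.d_ε ⟶
          ShortComplex.mk (Q.complex.d 1 0) (Q.ε ≫ S.f)
            (by rw [← Category.assoc, Q.d_ε, zero_comp]) :=
        { τ₁ := 𝟙 _, τ₂ := 𝟙 _, τ₃ := S.f }
      exact (ShortComplex.exact_iff_of_epi_of_isIso_of_mono φ).1 Q.exact_zero
    | succ l => exact Q.exact_succ l
  length := Q.length + 1
  isZero l hl := by
    cases l with
    | zero => omega
    | succ l => exact Q.isZero l (by omega)
  prop l hl := by
    cases l with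
    | zero => exact h₂
    | succ l => exact Q.prop l (by omega)

theorem nonempty {M : C} (h : HasFiniteResolution Pr M) :
    Nonempty (AugmentedResolution Pr M) := by
  induction h with
  | base h => exact ⟨self h⟩
  | step hS h₂ h₁ ih => exact ⟨splice hS h₂ ih.some⟩

/-- An augmented resolution by projectives as a projective resolution. -/
def projectiveResolution (hPr : ∀ P, Pr P → Projective P) {M : C}
    (Q : AugmentedResolution Pr M) : ProjectiveResolution M where
  complex := Q.complex
  projective l := by
    rcases le_or_gt l Q.length with h | h
    · exact hPr _ (Q.prop l h)
    · exact (Q.isZero l h).projective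
  π := (ChainComplex.toSingle₀Equiv _ _).symm ⟨Q.ε, Q.d_ε⟩
  quasiIso := ⟨fun n => by
    rcases n with - | n
    · rw [ChainComplex.quasiIsoAt₀_iff, ShortComplex.quasiIso_iff_of_zeros']
      · have hπ : ((ChainComplex.toSingle₀Equiv Q.complex M).symm ⟨Q.ε, Q.d_ε⟩).f 0 = Q.ε := by
          simp
        refine (ShortComplex.exact_and_epi_g_iff_of_iso ?_).2 ⟨Q.exact_zero, Q.epi_ε⟩
        exact ShortComplex.isoMk (Iso.refl _) (Iso.refl _) (Iso.refl _)
          ((Category.id_comp _).trans (Category.comp_id _).symm)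
          ((Category.id_comp _).trans (hπ.symm.trans (Category.comp_id _).symm))
      · exact Q.complex.shape _ _ (by simp)
      all_goals rfl
    · rw [quasiIsoAt_iff_exactAt']
      · rw [HomologicalComplex.exactAt_iff' _ (n + 2) (n + 1) n (by simp) (by simp)]
        exact Q.exact_succ _
      · apply ChainComplex.exactAt_succ_single_obj⟩

end AugmentedResolution

end FiniteResolutions

/-! ### Finitely generated projective modules -/

section FinProj

variable {R : Type u} [Ring R]

variable (R) in
/-- The regular module. -/
abbrev regular : ModuleCat.{u} R := ModuleCat.of R R

/-- Finitely generated projective modules: the identity factors as `P ⟶ Rᵐ ⟶ P`. -/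
def IsFinProj (P : ModuleCat.{u} R) : Prop :=
  ∃ (m : ℕ) (f : Fin m → (P ⟶ regular R)) (s : Fin m → (regular R ⟶ P)),
    ∑ a, f a ≫ s a = 𝟙 P

theorem IsFinProj.projective {P : ModuleCat.{u} R} (h : IsFinProj P) : Projective P := by
  obtain ⟨m, f, s, hfs⟩ := h
  have : Projective (regular R) := (IsProjective.iff_projective (R := R) R).1 inferInstance
  refine ⟨fun g p _ => ⟨∑ a, f a ≫ Projective.factorThru (s a ≫ g) p, ?_⟩⟩
  rw [Preadditive.sum_comp]
  simp only [Category.assoc, Projective.factorThru_comp]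
  simp only [← Category.assoc]
  rw [← Preadditive.sum_comp, hfs, Category.id_comp]

theorem isFinProj_of_finite (P : Type u) [AddCommGroup P] [Module R P] [Module.Finite R P]
    [Module.Projective R P] : IsFinProj (ModuleCat.of R P) := by
  obtain ⟨m, p, i, hp, hi, h⟩ := Module.Finite.exists_comp_eq_id_of_projective R P
  refine ⟨m, fun a => ModuleCat.ofHom (LinearMap.proj a ∘ₗ i),
    fun a => ModuleCat.ofHom (p ∘ₗ LinearMap.single R (fun _ => R) a), ?_⟩
  ext x
  have : ∑ a, Pi.single a (i x a) = i x := Finset.univ_sum_single _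
  simp only [ModuleCat.hom_sum, LinearMap.sum_apply]
  simp only [ModuleCat.hom_comp, ModuleCat.hom_ofHom, LinearMap.comp_apply, LinearMap.proj_apply,
    LinearMap.coe_single, ← map_sum, this]
  exact LinearMap.congr_fun h x

/-- Right multiplication by `r` on the regular module. -/
abbrev rightMul (r : R) : regular R ⟶ regular R :=
  ModuleCat.ofHom (LinearMap.toSpanSingleton R R r)

theorem eq_rightMul (f : regular R ⟶ regular R) : f = rightMul (f.hom (1 : R)) := by
  ext
  simp

/-- Finitely generated modules of finite projective dimension over a Noetherian ring have finite
resolutions by finitely generated projectives. -/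
theorem hasFiniteResolution_of_projectiveDimension [IsNoetherianRing R] (d : ℕ)
    (M : ModuleCat.{u} R) [Module.Finite R M] (h : HasProjectiveDimensionLE M d) :
    HasFiniteResolution IsFinProj M := by
  induction d generalizing M with
  | zero =>
    have : Projective M :=
      (projective_iff_hasProjectiveDimensionLE_zero M).2 h
    have : Module.Projective R M := (IsProjective.iff_projective (R := R) M).2 this
    exact .base (isFinProj_of_finite M)
  | succ d ih =>
    obtain ⟨m, p, hp⟩ := Module.Finite.exists_fin' R M
    let S : ShortComplex (ModuleCat.{u} R) :=
      ShortComplex.mk (X₃ := M) (ModuleCat.ofHom (LinearMap.ker p).subtype) (ModuleCat.ofHom p)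
        (by ext x; exact x.2)
    have hS : S.ShortExact :=
      { exact := (ShortComplex.moduleCat_exact_iff S).2 fun x hx => ⟨⟨x, hx⟩, rfl⟩
        mono_f := (ModuleCat.mono_iff_injective _).2 (Submodule.injective_subtype _)
        epi_g := (ModuleCat.epi_iff_surjective _).2 hp }
    have h₂ : IsFinProj S.X₂ := isFinProj_of_finite (Fin m → R)
    have hp₂ : Projective S.X₂ := h₂.projective
    have : Module.Finite R S.X₁ := inferInstanceAs (Module.Finite R (LinearMap.ker p))
    -- Dimension shift: the middle term is projective, so passing to the kernel lowers the
    -- projective dimension bound by one.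
    exact .step hS h₂ (ih _ ((hS.hasProjectiveDimensionLT_X₃_iff d hp₂).1 h))

end FinProj

/-! ### Traces on modules -/

/-- Over a field the sequence splits, so `id = i ρ' + σ p`. Inserting this after `b` and using
cyclicity leaves the traces of `a` and `c`; the splitting need not be compatible with the
endomorphisms. -/
theorem trace_shortExact {k U V W : Type*} [Field k] [AddCommGroup U] [Module k U]
    [AddCommGroup V] [Module k V] [AddCommGroup W] [Module k W] [Module.Finite k V]
    (i : U →ₗ[k] V) (p : V →ₗ[k] W) (hi : Function.Injective i) (hp : Function.Surjective p)
    (hip : Function.Exact i p) (a : U →ₗ[k] U) (b : V →ₗ[k] V) (c : W →ₗ[k] W)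
    (hab : b ∘ₗ i = i ∘ₗ a) (hbc : c ∘ₗ p = p ∘ₗ b) :
    LinearMap.trace k V b = LinearMap.trace k U a + LinearMap.trace k W c := by
  have : Module.Finite k U := Module.Finite.of_injective i hi
  have : Module.Finite k W := Module.Finite.of_surjective p hp
  obtain ⟨ρ, hρ⟩ := i.exists_leftInverse_of_injective (LinearMap.ker_eq_bot.2 hi)
  obtain ⟨σ, hσ⟩ := p.exists_rightInverse_of_surjective (LinearMap.range_eq_top.2 hp)
  have hpi : p ∘ₗ i = 0 := hip.linearMap_comp_eq_zero
  -- The retraction `ρ` is corrected so as to vanish on the image of `σ`; otherwise `h1` would fail.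
  let ρ' := ρ ∘ₗ (LinearMap.id - σ ∘ₗ p)
  have h1 : i ∘ₗ ρ' + σ ∘ₗ p = LinearMap.id := by
    ext x
    obtain ⟨u, hu⟩ := (hip (x - σ (p x))).1 (by
      rw [map_sub, show p (σ (p x)) = p x from LinearMap.congr_fun hσ (p x), sub_self])
    have h2 : ρ (i u) = u := LinearMap.congr_fun hρ u
    simp [ρ', -map_sub, ← hu, h2]
    simp [hu]
  have h2 : ρ' ∘ₗ i = LinearMap.id := by
    rw [LinearMap.comp_assoc, LinearMap.sub_comp, LinearMap.comp_assoc, hpi]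
    simpa using hρ
  calc LinearMap.trace k V b = LinearMap.trace k V (b ∘ₗ (i ∘ₗ ρ' + σ ∘ₗ p)) := by
        rw [h1, LinearMap.comp_id]
    _ = LinearMap.trace k V (i ∘ₗ (a ∘ₗ ρ')) + LinearMap.trace k V ((b ∘ₗ σ) ∘ₗ p) := by
        rw [LinearMap.comp_add, map_add, ← LinearMap.comp_assoc, hab, LinearMap.comp_assoc,
          LinearMap.comp_assoc]
    _ = LinearMap.trace k U a + LinearMap.trace k W c := by
        rw [LinearMap.trace_comp_comm' (a ∘ₗ ρ') i, LinearMap.trace_comp_comm' p (b ∘ₗ σ), LinearMap.comp_assoc, h2,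
          ← LinearMap.comp_assoc, ← hbc, LinearMap.comp_assoc, hσ, LinearMap.comp_id,
          LinearMap.comp_id]

/-- The trace of linear endomorphisms as an additive trace. -/
def linTrace (k : Type u) [Field k] : AdditiveTrace k (ModuleCat.{u} k) where
  fin M := Module.Finite k M
  tr {M} f := LinearMap.trace k M f.hom
  fin_iff {S} hS := by
    constructor
    · intro h
      exact ⟨Module.Finite.of_injective S.f.hom hS.moduleCat_injective_f,
        Module.Finite.of_surjective S.g.hom hS.moduleCat_surjective_g⟩
    · rintro ⟨h1, h3⟩
      exact Module.Finite.of_exact (f := S.f.hom) (g := S.g.hom)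
        ((ShortComplex.ShortExact.moduleCat_exact_iff_function_exact S).1 hS.exact)
        hS.moduleCat_surjective_g
  tr_shortExact {S} hS h f :=
    trace_shortExact S.f.hom S.g.hom hS.moduleCat_injective_f hS.moduleCat_surjective_g
      ((ShortComplex.ShortExact.moduleCat_exact_iff_function_exact S).1 hS.exact) _ _ _
      (by simpa using (congrArg ModuleCat.Hom.hom f.comm₁₂).symm)
      (by simpa using (congrArg ModuleCat.Hom.hom f.comm₂₃).symm)
  tr_add f g := by simp
  tr_comm hX hY f g := by
    simp only [ModuleCat.hom_comp]
    exact LinearMap.trace_comp_comm' _ _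

section ModTrace

variable (k : Type u) [Field k] {R : Type u} [Ring R] [Algebra k R]

/-- The trace of `r φ` for endomorphisms `φ` of an `R`-module. -/
def smulTrace (r : R) {M : Type u} [AddCommGroup M] [Module k M] [Module R M]
    [IsScalarTower k R M] (φ : M →ₗ[R] M) : k :=
  LinearMap.trace k M (Algebra.lsmul k k M r ∘ₗ φ.restrictScalars k)

/-- The trace of `r φ` as an additive trace on modules. -/
def modTrace (r : R) : AdditiveTrace k (ModuleCat.{u} R) where
  fin M := Module.Finite k M
  tr {M} f := smulTrace k r f.hom
  fin_iff {S} hS := by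
    constructor
    · intro h
      exact ⟨Module.Finite.of_injective (S.f.hom.restrictScalars k) hS.moduleCat_injective_f,
        Module.Finite.of_surjective (S.g.hom.restrictScalars k) hS.moduleCat_surjective_g⟩
    · rintro ⟨h1, h3⟩
      exact Module.Finite.of_exact (f := S.f.hom.restrictScalars k)
        (g := S.g.hom.restrictScalars k)
        ((ShortComplex.ShortExact.moduleCat_exact_iff_function_exact S).1 hS.exact)
        hS.moduleCat_surjective_g
  tr_shortExact {S} hS h f := by
    refine trace_shortExact (S.f.hom.restrictScalars k) (S.g.hom.restrictScalars k)
      hS.moduleCat_injective_f hS.moduleCat_surjective_g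
      ((ShortComplex.ShortExact.moduleCat_exact_iff_function_exact S).1 hS.exact) _ _ _ ?_ ?_
    · ext x
      have := LinearMap.congr_fun (congrArg ModuleCat.Hom.hom f.comm₁₂) x
      simp only [ModuleCat.hom_comp, LinearMap.comp_apply] at this
      simp [this]
    · ext x
      have := LinearMap.congr_fun (congrArg ModuleCat.Hom.hom f.comm₂₃) x
      simp only [ModuleCat.hom_comp, LinearMap.comp_apply] at this
      simp [this]
  tr_add f g := by
    simp only [smulTrace, ModuleCat.hom_add, ← map_add]
    congr 1
    ext x
    simp
  tr_comm {X Y} hX hY f g := by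
    have h1 : Algebra.lsmul k k X r ∘ₗ (f ≫ g).hom.restrictScalars k =
        g.hom.restrictScalars k ∘ₗ (Algebra.lsmul k k Y r ∘ₗ f.hom.restrictScalars k) := by
      ext x; simp
    have h2 : Algebra.lsmul k k Y r ∘ₗ (g ≫ f).hom.restrictScalars k =
        (Algebra.lsmul k k Y r ∘ₗ f.hom.restrictScalars k) ∘ₗ g.hom.restrictScalars k := by
      ext x; simp
    rw [smulTrace, smulTrace, h1, h2]
    exact LinearMap.trace_comp_comm' _ _

variable {k}

/-- A scalar `c` must act as `c • 1 : R`. This identifies the `k`-structure that an object of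
`ModuleCat R` carries with one given beforehand, so that `obtain rfl` can exchange them. -/
theorem module_eq_of_isScalarTower {M : Type u} [AddCommGroup M] [Module R M]
    (i₁ i₂ : Module k M) (h₁ : @IsScalarTower k R M _ _ i₁.toSMul)
    (h₂ : @IsScalarTower k R M _ _ i₂.toSMul) : i₁ = i₂ := by
  apply Module.ext' _ _
  intro c x
  rw [← one_smul R x]
  have e₁ := @IsScalarTower.smul_assoc k R M _ _ i₁.toSMul h₁ c 1 x
  have e₂ := @IsScalarTower.smul_assoc k R M _ _ i₂.toSMul h₂ c 1 x
  exact e₁.symm.trans e₂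

variable {M : Type u} [AddCommGroup M] [iM : Module k M] [Module R M] [hM : IsScalarTower k R M]

theorem moduleOfAlgebraModule_of :
    ModuleCat.moduleOfAlgebraModule (k := k) (ModuleCat.of R M) = iM :=
  module_eq_of_isScalarTower (R := R) (M := M) _ _
    (ModuleCat.isScalarTower_of_algebra_moduleCat (ModuleCat.of R M)) hM

theorem modTrace_ofHom (r : R) (φ : M →ₗ[R] M) :
    (modTrace k r).tr (ModuleCat.ofHom φ) = smulTrace k r φ := by
  obtain rfl := moduleOfAlgebraModule_of (k := k) (R := R) (M := M)
  rfl

theorem modTrace_fin_of (r : R) [Module.Finite k M] : (modTrace k r).fin (ModuleCat.of R M) := by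
  obtain rfl := moduleOfAlgebraModule_of (k := k) (R := R) (M := M)
  assumption

end ModTrace

/-! ### Traces on finitely generated projectives and on derived functors -/

section

variable {k : Type*} [Field k] {D : Type*} [Category* D] [Abelian D] (t : AdditiveTrace k D)

namespace AdditiveTrace

theorem fin_biprod {X Y : D} (hX : t.fin X) (hY : t.fin Y) : t.fin (X ⊞ Y) :=
  (t.fin_iff (ShortComplex.Splitting.ofHasBinaryBiproduct X Y).shortExact).2 ⟨hX, hY⟩

/-- The object `Y` is a biproduct of copies of `Q`. An object whose identity is a sum of maps
factoring through `Q` is then a retract of `Y`, hence finite. -/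
theorem exists_fin_factor {Q X : D} (hQ : t.fin Q) (m : ℕ) (s : Fin m → (Q ⟶ X)) :
    ∃ (Y : D) (_ : t.fin Y) (p : Y ⟶ X), ∀ a, ∃ v, v ≫ p = s a := by
  induction m with
  | zero => exact ⟨_, t.fin_of_isZero (isZero_zero D) hQ, 0, fun a => a.elim0⟩
  | succ m ih =>
    obtain ⟨Y, hY, p, hp⟩ := ih (fun a => s a.castSucc)
    refine ⟨Y ⊞ Q, t.fin_biprod hY hQ, biprod.desc p (s (Fin.last m)), fun a => ?_⟩
    induction a using Fin.lastCases with
    | last => exact ⟨biprod.inr, by simp⟩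
    | cast a =>
      obtain ⟨v, hv⟩ := hp a
      exact ⟨v ≫ biprod.inl, by simp [hv]⟩

theorem fin_of_sum_eq_id {Q X : D} (hQ : t.fin Q) (m : ℕ) (f : Fin m → (X ⟶ Q))
    (s : Fin m → (Q ⟶ X)) (h : ∑ a, f a ≫ s a = 𝟙 X) : t.fin X := by
  obtain ⟨Y, hY, p, hp⟩ := t.exists_fin_factor hQ m s
  choose v hv using hp
  have : (∑ a, f a ≫ v a) ≫ p = 𝟙 X := by
    rw [Preadditive.sum_comp, ← h]
    simp [hv]
  have : IsSplitEpi p := ⟨⟨⟨_, this⟩⟩⟩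
  exact t.fin_of_epi p hY

end AdditiveTrace

variable {R : Type u} [Ring R] (F : ModuleCat.{u} R ⥤ D) [F.Additive] (α : F ⟶ F)

theorem _root_.CategoryTheory.Functor.sum_map_comp_map_eq_id {P Q : ModuleCat.{u} R} {m : ℕ}
    {f : Fin m → (P ⟶ Q)} {s : Fin m → (Q ⟶ P)} (h : ∑ a, f a ≫ s a = 𝟙 P) :
    ∑ a, F.map (f a) ≫ F.map (s a) = 𝟙 (F.obj P) := by
  simp only [← F.map_comp, ← F.map_sum, h, F.map_id]

theorem fin_of_isFinProj (hfin : t.fin (F.obj (regular R))) {P : ModuleCat.{u} R}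
    (hP : IsFinProj P) : t.fin (F.obj P) := by
  obtain ⟨m, f, s, h⟩ := hP
  exact t.fin_of_sum_eq_id hfin m _ _ (F.sum_map_comp_map_eq_id h)

/-- The Hattori–Stallings argument: insert `id = ∑ F(f_a) F(s_a)` and move `F(f_a)` around by
cyclicity. What remains is an endomorphism of `F` of the regular module induced by `s_a ≫ β ≫ f_a`,
which is a right multiplication. -/
theorem tr_eq_sum_regular (hfin : t.fin (F.obj (regular R))) {P : ModuleCat.{u} R} {m : ℕ}
    {f : Fin m → (P ⟶ regular R)} {s : Fin m → (regular R ⟶ P)} (h : ∑ a, f a ≫ s a = 𝟙 P)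
    (β : P ⟶ P) : t.tr (F.map β ≫ α.app P) =
      ∑ a, t.tr (F.map (rightMul ((s a ≫ β ≫ f a).hom (1 : R))) ≫ α.app (regular R)) := by
  have h' := F.sum_map_comp_map_eq_id h
  have hP : t.fin (F.obj P) := t.fin_of_sum_eq_id hfin m _ _ h'
  rw [← Category.id_comp (F.map β ≫ α.app P), ← h', Preadditive.sum_comp, t.tr_sum]
  refine Finset.sum_congr rfl fun a _ => ?_
  rw [Category.assoc, t.tr_comm hP hfin, ← eq_rightMul]
  simp only [F.map_comp, Category.assoc, α.naturality, α.naturality_assoc]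

end

section DerivedTrace

variable {k : Type u} [Field k] {D : Type*} [Category* D] [Abelian D] (t : AdditiveTrace k D)
  {R : Type u} [Ring R] [Algebra k R]
  (F : ModuleCat.{u} R ⥤ D) [F.Additive] (α : F ⟶ F)

/-- Both sides are linear in `r` and vanish on nilpotents, so it suffices to compare them on the `f
p`. There `hT` says that `T` inverts the matrix of traces. -/
theorem sum_smul_eq_of_span {ι : Type*} [Fintype ι] [DecidableEq ι] {f : ι → R}
    (hf : ⊤ ≤ Submodule.span k (Set.range f ∪ {r | IsNilpotent r})) (T : Matrix ι ι k)
    (hT : ∀ i p, ∑ j, T i j * smulTrace k (f j) (LinearMap.toSpanSingleton R R (f p)) =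
      if i = p then 1 else 0)
    (g : R →ₗ[k] k) (hg : ∀ r, IsNilpotent r → g r = 0) (r : R) :
    g r = ∑ i, ∑ j, g (f i) * T i j *
      smulTrace k (f j) (LinearMap.toSpanSingleton R R r) := by
  have hr : r ∈ Submodule.span k (Set.range f ∪ {r | IsNilpotent r}) := hf trivial
  induction hr using Submodule.span_induction with
  | mem r hr =>
    rcases hr with ⟨p, rfl⟩ | hr
    · simp only [mul_assoc, ← Finset.mul_sum, hT]
      simp
    · have : ∀ j, smulTrace k (f j) (LinearMap.toSpanSingleton R R r) = 0 := by
        intro j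
        apply IsNilpotent.eq_zero
        apply LinearMap.isNilpotent_trace_of_isNilpotent
        obtain ⟨n, hn⟩ := hr
        refine ⟨n, ?_⟩
        -- Left and right multiplications commute, so nilpotency of right multiplication by `r`
        -- passes to the composite.
        have h1 : Algebra.lsmul k k R (f j) ∘ₗ
            (LinearMap.toSpanSingleton R R r).restrictScalars k =
            LinearMap.mulLeft k (f j) * LinearMap.mulRight k r := by
          ext x; simp
        rw [h1, (LinearMap.commute_mulLeft_right (R := k) (f j) r).mul_pow, LinearMap.pow_mulRight, hn]
        simp
      simp [this, hg r hr]
  | zero =>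
    have : ∀ j, smulTrace k (f j) (LinearMap.toSpanSingleton R R (0 : R)) = 0 := by
      intro j
      have : Algebra.lsmul k k R (f j) ∘ₗ
        (LinearMap.toSpanSingleton R R (0 : R)).restrictScalars k = 0 := by ext; simp
      rw [smulTrace, this, map_zero]
    simp only [map_zero, this, mul_zero, Finset.sum_const_zero]
  | add x y _ _ hx hy =>
    have : ∀ j, smulTrace k (f j) (LinearMap.toSpanSingleton R R (x + y)) =
        smulTrace k (f j) (LinearMap.toSpanSingleton R R x) +
          smulTrace k (f j) (LinearMap.toSpanSingleton R R y) := by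
      intro j
      simp only [smulTrace, ← map_add]
      congr 1
      ext
      simp [mul_add]
    rw [map_add, hx, hy]
    simp only [this, mul_add, Finset.sum_add_distrib]
  | smul c x _ hx =>
    have : ∀ j, smulTrace k (f j) (LinearMap.toSpanSingleton R R (c • x)) =
        c * smulTrace k (f j) (LinearMap.toSpanSingleton R R x) := by
      intro j
      simp only [smulTrace]
      rw [← smul_eq_mul, ← map_smul]
      congr 1
      ext
      simp
    rw [map_smul, hx]
    simp only [this, smul_eq_mul, Finset.mul_sum]
    exact Finset.sum_congr rfl fun i _ => Finset.sum_congr rfl fun j _ => by ring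

theorem isFinProj_of_isZero {P : ModuleCat.{u} R} (h : IsZero P) : IsFinProj P :=
  ⟨0, fun a => a.elim0, fun a => a.elim0, h.eq_of_src _ _⟩

/-- The trace formula for the derived functors of an additive functor on modules. -/
theorem derived_trace_formula [Module.Finite k R] {ι : Type*} [Fintype ι] [DecidableEq ι] {f : ι → R}
    (hf : ⊤ ≤ Submodule.span k (Set.range f ∪ {r | IsNilpotent r})) (T : Matrix ι ι k)
    (hT : ∀ i p, ∑ j, T i j * smulTrace k (f j) (LinearMap.toSpanSingleton R R (f p)) =
      if i = p then 1 else 0)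
    (hfin : t.fin (F.obj (regular R))) (g : R →ₗ[k] k) (hg : ∀ r, IsNilpotent r → g r = 0)
    (hF : ∀ r, t.tr (F.map (rightMul r) ≫ α.app (regular R)) = g r)
    {M : Type u} [AddCommGroup M] [Module k M] [Module R M] [IsScalarTower k R M]
    [Module.Finite k M] (hM : HasFiniteResolution IsFinProj (ModuleCat.of R M))
    (φ : M →ₗ[R] M) :
    (∀ l, t.fin ((F.leftDerived l).obj (ModuleCat.of R M))) ∧
    ∃ d : ℕ, (∀ l, d ≤ l → IsZero ((F.leftDerived l).obj (ModuleCat.of R M))) ∧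
      ∑ l ∈ Finset.range d, (-1 : k) ^ l * t.tr ((F.leftDerived l).map (ModuleCat.ofHom φ) ≫
        (NatTrans.leftDerived α l).app (ModuleCat.of R M)) =
      ∑ i, ∑ j, g (f i) * T i j * smulTrace k (f j) φ := by
  obtain ⟨Q⟩ := AugmentedResolution.nonempty hM
  let P := Q.projectiveResolution (fun _ h => h.projective)
  -- One past the length: the complex is zero in degree `d`, and `d > 0` keeps degree `0` within the
  -- range of summation.
  let d := Q.length + 1
  have hz : ∀ l, d ≤ l → IsZero (P.complex.X l) := fun l hl => Q.isZero l hl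
  have hP : ∀ l, IsFinProj (P.complex.X l) := by
    intro l
    rcases le_or_gt l Q.length with h | h
    · exact Q.prop l h
    · exact isFinProj_of_isZero (Q.isZero l h)
  let β : P.complex ⟶ P.complex := ProjectiveResolution.lift (ModuleCat.ofHom φ) P P
  have hβ : β ≫ P.π = P.π ≫ (ChainComplex.single₀ _).map (ModuleCat.ofHom φ) :=
    ProjectiveResolution.lift_commutes _ _ _
  let K := (F.mapHomologicalComplex (ComplexShape.down ℕ)).obj P.complex
  let γ : K ⟶ K := (F.mapHomologicalComplex _).map β ≫
    (NatTrans.mapHomologicalComplex α _).app P.complex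
  have hK : ∀ l, t.fin (K.X l) := fun l => fin_of_isFinProj t F hfin (hP l)
  have hKz : ∀ l, d ≤ l → IsZero (K.X l) := fun l hl => F.map_isZero (hz l hl)
  -- The induced operator on the derived functors is conjugate to the action of `γ` on the homology
  -- of `F(P)`.
  have hconj : ∀ l, ((F.leftDerived l).map (ModuleCat.ofHom φ) ≫
      (NatTrans.leftDerived α l).app (ModuleCat.of R M)) ≫ (P.isoLeftDerivedObj F l).hom =
      (P.isoLeftDerivedObj F l).hom ≫ HomologicalComplex.homologyMap γ l := by
    intro l
    rw [F.leftDerived_map_eq l _ β hβ, P.leftDerived_app_eq α l]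
    simp only [Category.assoc, Iso.inv_hom_id, Category.comp_id, Iso.inv_hom_id_assoc]
    congr 1
    simp only [γ, HomologicalComplex.homologyMap_comp]
    rfl
  have hfinD : ∀ l, t.fin ((F.leftDerived l).obj (ModuleCat.of R M)) := fun l =>
    t.fin_of_mono (P.isoLeftDerivedObj F l).hom (t.fin_homology hK l)
  refine ⟨hfinD, d, fun l hl => ?_, ?_⟩
  · exact (AdditiveTrace.isZero_homology l (hKz l hl)).of_iso (P.isoLeftDerivedObj F l)
  -- Hopf for the augmentation of `P`: the complex on the other side is `M` in degree `0`, which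
  -- contributes the only term.
  · have htv : ∀ j, ∑ l ∈ Finset.range d, (-1 : k) ^ l * (modTrace k (f j)).tr (β.f l) =
        smulTrace k (f j) φ := by
      intro j
      have hMfin : (modTrace k (f j)).fin (ModuleCat.of R M) := modTrace_fin_of (f j)
      have hs : ∀ l, 0 < l → IsZero (((ChainComplex.single₀ _).obj (ModuleCat.of R M)).X l) :=
        fun l hl => HomologicalComplex.isZero_single_obj_X (ComplexShape.down ℕ) 0 _ l (by omega)
      rw [(modTrace k (f j)).hopf_quasiIso β _ P.π hβ
        (fun l => fin_of_isFinProj (modTrace k (f j)) (𝟭 _) (modTrace_fin_of (f j)) (hP l))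
        (fun l => ?_) d (hz d le_rfl) (hs d (by omega))]
      · rw [Finset.sum_eq_single 0]
        · rw [pow_zero, one_mul]
          exact modTrace_ofHom (f j) φ
        · intro l _ hl
          rw [(modTrace k (f j)).tr_of_isZero (hs l (by omega)), mul_zero]
        · intro h
          exact absurd (Finset.mem_range.2 (by omega)) h
      · rcases Nat.eq_zero_or_pos l with rfl | hl
        · exact hMfin
        · exact (modTrace k (f j)).fin_of_isZero (hs l hl) hMfin
    -- Hattori–Stallings is applied twice to the same data on `P_l`, once for `F` and once for the
    -- identity functor with the trace of `f j`. The two sums match term by term through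
    -- `sum_smul_eq_of_span`.
    have hproj : ∀ l, t.tr (γ.f l) = ∑ i, ∑ j, g (f i) * T i j *
        (modTrace k (f j)).tr (β.f l) := by
      intro l
      obtain ⟨m, u, s, hus⟩ := hP l
      have h1 : t.tr (γ.f l) = _ := tr_eq_sum_regular t F α hfin hus (β.f l)
      have h2 : ∀ j, (modTrace k (f j)).tr (β.f l) =
          ∑ a, smulTrace k (f j) (LinearMap.toSpanSingleton R R
            ((s a ≫ β.f l ≫ u a).hom (1 : R))) := by
        intro j
        have h3 := tr_eq_sum_regular (modTrace k (f j)) (𝟭 _) (𝟙 _)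
          (modTrace_fin_of (f j)) hus (β.f l)
        simp only [Functor.id_map, NatTrans.id_app, Category.comp_id, modTrace_ofHom] at h3
        rw [← h3]
      rw [h1]
      simp only [hF, h2, Finset.mul_sum]
      rw [Finset.sum_congr rfl fun a _ => sum_smul_eq_of_span hf T hT g hg _]
      rw [Finset.sum_comm]
      exact Finset.sum_congr rfl fun i _ => Finset.sum_comm
    have htr : ∀ l, t.tr ((F.leftDerived l).map (ModuleCat.ofHom φ) ≫
        (NatTrans.leftDerived α l).app (ModuleCat.of R M)) =
        t.tr (HomologicalComplex.homologyMap γ l) := fun l =>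
      t.tr_conj _ (hfinD l) _ _ (hconj l)
    rw [Finset.sum_congr rfl fun l _ => congrArg ((-1 : k) ^ l * ·) (htr l)]
    refine (t.hopf γ hK d (hKz d le_rfl)).symm.trans ?_
    simp only [hproj, Finset.mul_sum]
    rw [Finset.sum_comm]
    refine Finset.sum_congr rfl fun i _ => ?_
    rw [Finset.sum_comm]
    refine Finset.sum_congr rfl fun j _ => ?_
    rw [← htv j, Finset.mul_sum]
    exact Finset.sum_congr rfl fun l _ => by ring

end DerivedTrace

/-! ### Super traces on Ext and Tor -/

section ExtTorTrace

variable {k : Type u} [Field k] {B : Type u} [Ring B] [Algebra k B]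

section SmulTraceLinear

variable {R : Type u} [Ring R] [Algebra k R] {N : Type u} [AddCommGroup N] [Module k N]
  [Module R N] [IsScalarTower k R N] (ψ : N →ₗ[R] N)

variable (k) in
/-- The trace of `r ψ` as a linear form in `r`. -/
def smulTraceLinear : R →ₗ[k] k where
  toFun r := smulTrace k r ψ
  map_add' r s := by simp only [smulTrace, map_add, LinearMap.add_comp]
  map_smul' c r := by simp only [smulTrace, map_smul, LinearMap.smul_comp, RingHom.id_apply]

/-- By linearity `ψ` commutes with the action of `r`, so `(r ψ)^n = r^n ψ^n`, and the trace of a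
nilpotent operator vanishes. -/
theorem smulTraceLinear_nilpotent (r : R) (hr : IsNilpotent r) :
    smulTraceLinear k ψ r = 0 := by
  apply IsNilpotent.eq_zero
  apply LinearMap.isNilpotent_trace_of_isNilpotent
  obtain ⟨n, hn⟩ := hr
  refine ⟨n, ?_⟩
  have hc : Commute (Algebra.lsmul k k N r) (ψ.restrictScalars k) := by
    ext x
    simp
  change (Algebra.lsmul k k N r * ψ.restrictScalars k) ^ n = 0
  rw [hc.mul_pow, ← map_pow, hn, map_zero, zero_mul]

end SmulTraceLinear

/-- Homomorphisms from the regular module are elements. -/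
def homRegularEquiv {R : Type u} [Ring R] [Algebra k R] (N : ModuleCat.{u} R) :
    (regular R ⟶ N) ≃ₗ[k] N where
  toFun h := h.hom (1 : R)
  invFun n := ModuleCat.ofHom (LinearMap.toSpanSingleton R N n)
  left_inv h := by ext; simp
  right_inv n := by simp
  map_add' h h' := by simp
  map_smul' c h := by simp

section BalancedRegular

variable {P : ModuleCat.{u} Bᵐᵒᵖ} (u : P ≃ₗ[Bᵐᵒᵖ] Bᵐᵒᵖ) (N : ModuleCat.{u} B)

/-- The multiplication map `P ⊗_B N → N` for a free module `P` of rank one. -/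
def balancedRegularMap : balancedTensor k B P N →ₗ[k] N :=
  Submodule.liftQ _ (TensorProduct.lift (LinearMap.mk₂ k
    (fun (b : P) (n : N) => unop (u b) • n)
    (fun b b' n => by rw [map_add, MulOpposite.unop_add, add_smul])
    (fun c b n => by
      have h : u (c • b) = c • u b := (u.restrictScalars k).map_smul c b
      rw [h, unop_smul, smul_assoc])
    (fun b n n' => smul_add _ n n')
    (fun c b n => smul_comm (unop (u b)) c n))) (by
    rw [balancing, Submodule.span_le]
    rintro _ ⟨m, r, n, rfl⟩
    simp [mul_smul])

/-- The isomorphism `P ⊗_B N ≅ N` for a free module `P` of rank one. -/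
def balancedRegularEquiv : balancedTensor k B P N ≃ₗ[k] N :=
  LinearEquiv.ofLinearMap (balancedRegularMap u N)
    ((balancing k B P N).mkQ ∘ₗ TensorProduct.mk k P N (u.symm 1))
    (by
      ext n
      change unop (u (u.symm 1)) • n = n
      simp)
    (by
      apply balanced_ext
      intro m n
      refine (Submodule.Quotient.eq _).2 ?_
      have h : op (unop (u m)) • u.symm 1 = m := by
        rw [← map_smul]
        simp
      have := Submodule.neg_mem (balancing k B P N)
        (Submodule.subset_span ⟨u.symm 1, unop (u m), n, rfl⟩)
      rw [neg_sub, h] at this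
      exact this)

end BalancedRegular

section

variable [Module.Finite k B] {ι : Type*} [Fintype ι] [DecidableEq ι] {f : ι → Bᵐᵒᵖ}
  (hf : ⊤ ≤ Submodule.span k (Set.range f ∪ {r | IsNilpotent r})) (T : Matrix ι ι k)
  (hT : ∀ i p, ∑ j, T i j *
    smulTrace k (f j) (LinearMap.toSpanSingleton Bᵐᵒᵖ Bᵐᵒᵖ (f p)) = if i = p then 1 else 0)
  {M : Type u} [AddCommGroup M] [Module k M] [Module Bᵐᵒᵖ M] [IsScalarTower k Bᵐᵒᵖ M]
  [Module.Finite k M] (hM : HasFiniteResolution IsFinProj (ModuleCat.of Bᵐᵒᵖ M))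
  (φ : M →ₗ[Bᵐᵒᵖ] M)

include hf hT hM

/-- `Ext` is the left derived functor of `Hom(-, N)` viewed as a covariant functor to the opposite
of vector spaces, whence the trace `(linTrace k).op`. Evaluation at `1` identifies `Hom(R, N)` with
`N`, and precomposition with right multiplication by `r` with the action of `r`. In `hN` the element
`0` is a placeholder: `fin` does not depend on it. -/
theorem hasSuperTrace_extEnd (N : ModuleCat.{u} Bᵐᵒᵖ) (hN : (modTrace k (0 : Bᵐᵒᵖ)).fin N)
    (ψ : N ⟶ N) :
    HasSuperTrace (fun l => extEnd k l (ModuleCat.ofHom φ) ψ)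
      (∑ i, ∑ j, (modTrace k (f i)).tr ψ * T i j * smulTrace k (f j) φ) := by
  have : Module.Finite k N := hN
  let E := homRegularEquiv (k := k) N
  obtain ⟨h1, d, h2, h3⟩ := derived_trace_formula (linTrace k).op
    (((linearYoneda k (ModuleCat.{u} Bᵐᵒᵖ)).obj N).rightOp)
    (NatTrans.rightOp ((linearYoneda k (ModuleCat.{u} Bᵐᵒᵖ)).map ψ))
    hf T hT (Module.Finite.equiv E.symm) (smulTraceLinear k ψ.hom)
    (smulTraceLinear_nilpotent ψ.hom)
    (fun r => by
      refine (LinearMap.trace_conj' _ E).symm.trans ?_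
      change LinearMap.trace k N _ = LinearMap.trace k N _
      congr 1
      ext n
      change ψ.hom (LinearMap.toSpanSingleton Bᵐᵒᵖ N n ((1 : Bᵐᵒᵖ) • r)) = r • ψ.hom n
      simp) hM φ
  refine ⟨fun l => h1 l, d, fun l hl => ?_, ?_⟩
  · exact ModuleCat.subsingleton_of_isZero (h2 l hl).unop
  -- Passing to the opposite category reverses the composite of the `φ`- and `ψ`-parts; naturality
  -- restores the order used in `extEnd`.
  · simp only [NatTrans.naturality] at h3
    exact h3

theorem hasSuperTrace_torEnd (N : ModuleCat.{u} B) (hN : (modTrace k (0 : B)).fin N)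
    (ψ : N ⟶ N) :
    HasSuperTrace (fun l => torEnd k l (ModuleCat.ofHom φ) ψ)
      (∑ i, ∑ j, (modTrace k (unop (f i))).tr ψ * T i j * smulTrace k (f j) φ) := by
  have : Module.Finite k N := hN
  let E := balancedRegularEquiv (k := k) (P := regular Bᵐᵒᵖ) (LinearEquiv.refl _ _) N
  obtain ⟨h1, d, h2, h3⟩ := derived_trace_formula (linTrace k) (tensorRight k N)
    (tensorRightMap k ψ) hf T hT (Module.Finite.equiv E.symm)
    (smulTraceLinear k ψ.hom ∘ₗ (opLinearEquiv k).symm.toLinearMap)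
    (fun r ⟨n, hn⟩ => smulTraceLinear_nilpotent ψ.hom (unop r)
      ⟨n, by rw [← unop_pow, hn, MulOpposite.unop_zero]⟩)
    (fun r => by
      refine (LinearMap.trace_conj' _ E).symm.trans ?_
      change LinearMap.trace k N _ = LinearMap.trace k N _
      congr 1
      ext n
      change unop ((1 : Bᵐᵒᵖ) * r) • ψ.hom n = unop r • ψ.hom n
      rw [one_mul]) hM φ
  refine ⟨fun l => h1 l, d, fun l hl => ?_, ?_⟩
  · exact ModuleCat.subsingleton_of_isZero (h2 l hl)
  · exact h3

variable {N : Type u} [AddCommGroup N] [Module k N] [Module.Finite k N]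

theorem hasSuperTrace_ext [Module Bᵐᵒᵖ N] [IsScalarTower k Bᵐᵒᵖ N] (ψ : N →ₗ[Bᵐᵒᵖ] N) :
    HasSuperTrace (fun l => extEnd k l (ModuleCat.ofHom φ) (ModuleCat.ofHom ψ))
      (∑ i, ∑ j, smulTrace k (f i) ψ * T i j * smulTrace k (f j) φ) := by
  have h := hasSuperTrace_extEnd hf T hT hM φ _ (modTrace_fin_of (M := N) 0) (ModuleCat.ofHom ψ)
  simpa only [modTrace_ofHom] using h

theorem hasSuperTrace_tor [Module B N] [IsScalarTower k B N] (ψ : N →ₗ[B] N) :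
    HasSuperTrace (fun l => torEnd k l (ModuleCat.ofHom φ) (ModuleCat.ofHom ψ))
      (∑ i, ∑ j, smulTrace k (unop (f i)) ψ * T i j * smulTrace k (f j) φ) := by
  have h := hasSuperTrace_torEnd hf T hT hM φ _ (modTrace_fin_of (M := N) 0) (ModuleCat.ofHom ψ)
  simpa only [modTrace_ofHom] using h

end

end ExtTorTrace

/-! ### Characters of an elementary algebra -/

section Characters

variable {k A : Type u} [Field k] [Ring A] [Algebra k A] {n : ℕ}

/-- A basic splitting of `A` along the idempotents `e`: characters `χ i` dual to the `e i` whose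
common kernel is a nilpotent ideal. -/
structure Splitting (k : Type u) {A : Type u} [Field k] [Ring A] [Algebra k A] {n : ℕ}
    (e : Fin n → A) where
  /-- the radical -/
  J : Ideal A
  twoSided : J.IsTwoSided
  /-- the nilpotency exponent -/
  r : ℕ
  pow_eq : J ^ r = ⊥
  /-- the characters -/
  χ : Fin n → A →ₐ[k] k
  χ_e : ∀ i j, χ i (e j) = if i = j then 1 else 0
  mem_J : ∀ a, a ∈ J ↔ ∀ i, χ i a = 0

/-- Modulo the radical, each `e i` becomes a vector of zeros and ones in `k^m`. It is nonzero since
a nilpotent idempotent is zero, and primitivity leaves exactly one coordinate `c i` equal to `1`.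
Orthogonality and completeness make `c` a bijection, and `χ i` is the coordinate `c i`. -/
theorem exists_splitting [FiniteDimensional k A] (hA : IsElementary k A) {e : Fin n → A}
    (he : IsCompletePrimitive e) : Nonempty (Splitting k e) := by
  obtain ⟨m, ⟨E⟩⟩ := hA
  have : IsArtinianRing A := IsArtinianRing.of_finite k A
  have hnil : IsNilpotent (Ring.jacobson A) := IsSemiprimaryRing.isNilpotent
  obtain ⟨r, hr⟩ := hnil
  let π : A →ₐ[k] (Fin m → k) := E.toAlgHom.comp (Ideal.Quotient.mkₐ k (Ring.jacobson A))
  have hπ : Function.Surjective π := E.surjective.comp Ideal.Quotient.mk_surjective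
  have hker : ∀ a, π a = 0 ↔ a ∈ Ring.jacobson A := by
    intro a
    rw [← Ideal.Quotient.eq_zero_iff_mem, ← map_eq_zero_iff E E.injective]
    rfl
  have hnilel : ∀ a, π a = 0 → IsNilpotent a := by
    intro a ha
    refine ⟨r, ?_⟩
    have := Ideal.pow_mem_pow ((hker a).1 ha) r
    rw [hr] at this
    simpa using this
  have hidem : ∀ i, IsIdempotentElem (π (e i)) := fun i => (he.complete.idem i).map π
  have hval : ∀ i c, π (e i) c = 0 ∨ π (e i) c = 1 := by
    intro i c
    have h : π (e i) c * π (e i) c = π (e i) c := congrFun (hidem i) c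
    exact IsIdempotentElem.iff_eq_zero_or_one.1 h
  have hex : ∀ i, ∃ c, π (e i) c = 1 := by
    intro i
    by_contra! hcon
    have h0 : π (e i) = 0 := funext fun c => (hval i c).resolve_right (hcon c)
    exact (he.primitive i).2.1 ((he.complete.idem i).eq_zero_of_isNilpotent (hnilel _ h0))
  choose c hc using hex
  -- With two coordinates equal to `1`, lifting the indicator of `c i` would split `e i` into two
  -- nonzero orthogonal idempotents.
  have huniq : ∀ i d, π (e i) d = 1 → d = c i := by
    intro i d hd
    by_contra hne
    have hmul : Pi.single (c i) (1 : k) * π (1 - e i) = 0 := by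
      ext x
      by_cases hx : x = c i
      · subst hx; simp [hc i]
      · simp [hx]
    -- The lift is taken orthogonal to `1 - e i`, which gives `e' = e' * e i = e i * e'`.
    obtain ⟨e', h1, h2, h3, h4⟩ := exists_isIdempotentElem_mul_eq_zero_of_ker_isNilpotent
      π.toRingHom (fun x hx => hnilel x hx) (Pi.single (c i) (1 : k)) (hπ _)
      (by ext x; by_cases hx : x = c i <;> simp [hx]) (1 - e i)
      (he.complete.idem i).one_sub hmul (by rw [mul_comm]; exact hmul)
    replace h2 : π e' = Pi.single (c i) 1 := h2
    rw [mul_sub, mul_one, sub_eq_zero] at h3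
    rw [sub_mul, one_mul, sub_eq_zero] at h4
    have hi := he.complete.idem i
    rcases (he.primitive i).2.2 e' (e i - e') h1
      (by
        rw [IsIdempotentElem, mul_sub, sub_mul, sub_mul, hi.eq, ← h4, ← h3, h1.eq]
        simp)
      (by rw [mul_sub, ← h3, h1.eq, sub_self]) (by rw [sub_mul, ← h4, h1.eq, sub_self])
      (by abel) with h0 | h0
    · rw [h0, map_zero] at h2
      have := congrFun h2 (c i)
      simp at this
    · rw [sub_eq_zero] at h0
      rw [← h0] at h2
      have := congrFun h2 d
      rw [hd, Pi.single_eq_of_ne hne] at this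
      exact one_ne_zero this
  have horth : ∀ i j, i ≠ j → π (e j) (c i) = 0 := by
    intro i j hij
    have h : π (e i) (c i) * π (e j) (c i) = 0 := by
      have := congrArg π (he.complete.ortho hij)
      rw [map_mul, map_zero] at this
      exact congrFun this (c i)
    rwa [hc i, one_mul] at h
  -- The `e i` sum to `1`, so at every coordinate `d` some `e i` is nonzero, and then `d = c i`.
  have hsurj : Function.Surjective c := by
    intro d
    have h1 : ∑ i, π (e i) d = 1 := by
      have := congrArg π he.complete.complete
      rw [map_sum, map_one] at this
      simpa using congrFun this d
    obtain ⟨i, -, hi⟩ := Finset.exists_ne_zero_of_sum_ne_zero (h1.trans_ne one_ne_zero)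
    exact ⟨i, (huniq i d ((hval i d).resolve_left hi)).symm⟩
  refine ⟨⟨Ring.jacobson A, inferInstance, r, hr, fun i => (Pi.evalAlgHom k _ (c i)).comp π,
    fun i j => ?_, fun a => ?_⟩⟩
  · by_cases hij : i = j
    · subst hij; simpa using hc i
    · simpa [hij] using horth i j hij
  · rw [← hker]
    constructor
    · intro h i
      simp [h]
    · intro h
      ext d
      obtain ⟨i, rfl⟩ := hsurj d
      exact h i

namespace Splitting

variable {e : Fin n → A} (s : Splitting k e)
include s

theorem sub_mem (a : A) : a - ∑ i, s.χ i a • e i ∈ s.J := by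
  rw [s.mem_J]
  intro i
  simp [s.χ_e]

theorem isNilpotent {a : A} (ha : a ∈ s.J) : IsNilpotent a := by
  refine ⟨s.r, ?_⟩
  have := Ideal.pow_mem_pow ha s.r
  rw [s.pow_eq] at this
  simpa using this

/-- An element is its diagonal part `∑ χ_i(a) e_i` plus an element of the nilpotent ideal `J`. -/
theorem span_eq_top : ⊤ ≤ Submodule.span k (Set.range e ∪ {r : A | IsNilpotent r}) := by
  intro a _
  rw [← sub_add_cancel a (∑ i, s.χ i a • e i)]
  refine add_mem (Submodule.subset_span (Or.inr (s.isNilpotent (s.sub_mem a))))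
    (sum_mem fun i _ => Submodule.smul_mem _ _ (Submodule.subset_span (Or.inl ⟨i, rfl⟩)))

end Splitting

end Characters

/-! ### Dimension vectors -/

section DimVec

variable (k : Type u) [Field k] {R : Type u} [Ring R] [Algebra k R]

/-- The dimension of `e M`. -/
def pieceDim (e : R) (M : Type u) [AddCommGroup M] [Module k M] [Module R M]
    [IsScalarTower k R M] : ℤ :=
  Module.finrank k (piece k M e)

theorem mem_piece {e : R} (he : IsIdempotentElem e) {M : Type u} [AddCommGroup M] [Module k M]
    [Module R M] [IsScalarTower k R M] (x : M) : x ∈ piece k M e ↔ e • x = x := by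
  constructor
  · rintro ⟨y, rfl⟩
    simp [← mul_smul, he.eq]
  · intro h
    exact ⟨x, h⟩

theorem pieceDim_of_exact {e : R} (he : IsIdempotentElem e) {U V W : Type u}
    [AddCommGroup U] [Module k U] [Module R U] [IsScalarTower k R U]
    [AddCommGroup V] [Module k V] [Module R V] [IsScalarTower k R V]
    [AddCommGroup W] [Module k W] [Module R W] [IsScalarTower k R W] [Module.Finite k V]
    (i : U →ₗ[R] V) (p : V →ₗ[R] W) (hi : Function.Injective i) (hp : Function.Surjective p)
    (hip : Function.Exact i p) : pieceDim k e V = pieceDim k e U + pieceDim k e W := by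
  let p' : piece k V e →ₗ[k] piece k W e := (p.restrictScalars k).restrict (by
    intro x hx
    rw [mem_piece k he] at hx ⊢
    simp [← map_smul, hx])
  let i' : piece k U e →ₗ[k] piece k V e := (i.restrictScalars k).restrict (by
    intro x hx
    rw [mem_piece k he] at hx ⊢
    simp [← map_smul, hx])
  have hi' : Function.Injective i' := fun x y h =>
    Subtype.ext (hi (congrArg Subtype.val h))
  have hp' : Function.Surjective p' := by
    rintro ⟨w, hw⟩
    rw [mem_piece k he] at hw
    obtain ⟨v, rfl⟩ := hp w
    refine ⟨⟨e • v, (mem_piece k he _).2 (by rw [← mul_smul, he.eq])⟩, Subtype.ext ?_⟩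
    change p (e • v) = p v
    rw [map_smul, hw]
  have hker : LinearMap.ker p' = LinearMap.range i' := by
    ext ⟨v, hv⟩
    rw [mem_piece k he] at hv
    rw [LinearMap.mem_ker, LinearMap.mem_range]
    constructor
    · intro h
      obtain ⟨x, rfl⟩ := (hip v).1 (congrArg Subtype.val h)
      refine ⟨⟨x, (mem_piece k he _).2 (hi ?_)⟩, rfl⟩
      rw [map_smul, hv]
    · rintro ⟨⟨x, hx⟩, h⟩
      apply Subtype.ext
      have h' : i x = v := congrArg Subtype.val h
      change p v = 0
      rw [← h']
      exact hip.apply_apply_eq_zero x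
  have h1 := LinearMap.finrank_range_add_finrank_ker p'
  rw [hker, LinearMap.range_eq_top.2 hp', finrank_top, LinearMap.finrank_range_of_inj hi'] at h1
  simp only [pieceDim]
  rw [← h1]
  push_cast
  ring

end DimVec

/-! ### The Cartan matrix -/

section CartanMatrix

variable {k A : Type u} [Field k] [Ring A] [Algebra k A] {n : ℕ}

/-- The one-dimensional right module defined by a character. -/
def CharModule (_χ : A →ₐ[k] k) : Type u := k

namespace CharModule

variable (χ : A →ₐ[k] k)

instance : AddCommGroup (CharModule χ) := inferInstanceAs (AddCommGroup k)
instance : Module k (CharModule χ) := inferInstanceAs (Module k k)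
instance : Module.Finite k (CharModule χ) := inferInstanceAs (Module.Finite k k)
instance : Module Aᵐᵒᵖ (CharModule χ) :=
  Module.compHom k (χ.toRingHom.fromOpposite fun _ _ => mul_comm _ _)

instance : IsScalarTower k Aᵐᵒᵖ (CharModule χ) where
  smul_assoc c a x := by
    obtain ⟨a, rfl⟩ := op_surjective a
    change χ (c • a) * @id k x = c * (χ a * @id k x)
    rw [map_smul, smul_eq_mul, mul_assoc]

open scoped Classical in
theorem pieceDim_eq {a : A} (c : k) (h : χ a = c) :
    pieceDim k (op a) (CharModule χ) = if c = 0 then 0 else 1 := by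
  have hp : piece k (CharModule χ) (op a) = if c = 0 then ⊥ else ⊤ := by
    split_ifs with hc
    · rw [eq_bot_iff]
      rintro _ ⟨x, rfl⟩
      change χ a * @id k x = 0
      rw [h, hc, zero_mul]
    · rw [eq_top_iff]
      rintro x -
      refine ⟨(c⁻¹ * @id k x : k), ?_⟩
      change χ a * (c⁻¹ * @id k x) = @id k x
      rw [h, ← mul_assoc, mul_inv_cancel₀ hc, one_mul]
  rw [pieceDim, hp]
  split_ifs with hc
  · rw [if_pos hc]
    simp
  · rw [if_neg hc, finrank_top]
    exact_mod_cast Module.finrank_self k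

end CharModule

/-- Left multiplication as an endomorphism of the right regular module. -/
def leftMul (a : A) : A →ₗ[Aᵐᵒᵖ] A where
  toFun x := a * x
  map_add' := mul_add a
  map_smul' b x := (mul_assoc a x (unop b)).symm

@[simp]
theorem leftMul_apply (a x : A) : leftMul a x = a * x := rfl

/-- With `f = e_j`, this makes column `j` of the Cartan matrix the dimension vector of the
projective module `e_j A`. -/
theorem pieceDim_range_leftMul (f e : A) :
    pieceDim k (op e) (LinearMap.range (leftMul f)) = Module.finrank k (biPiece k A f e) := by
  have h : biPiece k A f e = (piece k (LinearMap.range (leftMul f)) (op e)).map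
      ((LinearMap.range (leftMul f)).subtype.restrictScalars k) := by
    ext y
    simp only [biPiece, piece, Submodule.mem_map, LinearMap.mem_range]
    constructor
    · rintro ⟨x, rfl⟩
      refine ⟨_, ⟨⟨f * x, x, rfl⟩, rfl⟩, ?_⟩
      exact mul_assoc f x e
    · rintro ⟨_, ⟨⟨_, x, rfl⟩, rfl⟩, rfl⟩
      exact ⟨x, (mul_assoc f x e).symm⟩
  rw [pieceDim, h]
  congr 1
  exact (Submodule.equivMapOfInjective
    ((LinearMap.range (leftMul f)).subtype.restrictScalars k)
    (LinearMap.range (leftMul f)).injective_subtype _).finrank_eq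

/-- The dimension vector of a right module. -/
def dimVec (k : Type u) [Field k] [Algebra k A] (e : Fin n → A) (M : Type u) [AddCommGroup M]
    [Module k M] [Module Aᵐᵒᵖ M] [IsScalarTower k Aᵐᵒᵖ M] : Fin n → ℤ :=
  fun i => pieceDim k (op (e i)) M

/-- The dimension vector of an object of the category of right modules. -/
def dimVecObj (k : Type u) [Field k] [Algebra k A] (e : Fin n → A) (M : ModuleCat.{u} Aᵐᵒᵖ) :
    Fin n → ℤ :=
  dimVec k e M

theorem dimVecObj_of (e : Fin n → A) (M : Type u) [AddCommGroup M] [Module k M]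
    [Module Aᵐᵒᵖ M] [IsScalarTower k Aᵐᵒᵖ M] :
    dimVecObj k e (ModuleCat.of Aᵐᵒᵖ M) = dimVec k e M := by
  obtain rfl := moduleOfAlgebraModule_of (k := k) (R := Aᵐᵒᵖ) (M := M)
  rfl

namespace Splitting

variable {e : Fin n → A} (s : Splitting k e)

/-- The subspace `M J` of a right module. -/
def radSub (I : Ideal A) (M : Type u) [AddCommGroup M] [Module k M] [Module Aᵐᵒᵖ M]
    [IsScalarTower k Aᵐᵒᵖ M] : Submodule k M :=
  Submodule.span k {y | ∃ a ∈ I, ∃ x : M, y = op a • x}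

variable {M : Type u} [AddCommGroup M] [Module k M] [Module Aᵐᵒᵖ M] [IsScalarTower k Aᵐᵒᵖ M]

include s in
-- Nakayama for a nilpotent ideal: `M = M J` gives `M = M J^m` for all `m`, and `J^r = 0`.
theorem subsingleton_of_radSub_eq_top (h : (radSub s.J M : Submodule k M) = ⊤) :
    Subsingleton M := by
  have := s.twoSided
  have key : ∀ m : ℕ, (radSub (s.J ^ m) M : Submodule k M) = ⊤ := by
    intro m
    induction m with
    | zero =>
      rw [eq_top_iff]
      intro x _
      exact Submodule.subset_span ⟨1, by rw [Submodule.pow_zero, Ideal.one_eq_top]; trivial, x,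
        by simp⟩
    | succ m ih =>
      rw [eq_top_iff, ← ih, radSub, Submodule.span_le]
      rintro _ ⟨a, ha, x, rfl⟩
      have hx : x ∈ (radSub s.J M : Submodule k M) := h ▸ Submodule.mem_top
      induction hx using Submodule.span_induction with
      | mem x hx =>
        obtain ⟨b, hb, y, rfl⟩ := hx
        refine Submodule.subset_span ⟨b * a, ?_, y, ?_⟩
        · rw [Ideal.IsTwoSided.pow_succ]
          exact Ideal.mul_mem_mul hb ha
        · rw [MulOpposite.op_mul, mul_smul]
      | zero => simp
      | add x y _ _ hx hy =>
        rw [smul_add]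
        exact add_mem hx hy
      | smul c x _ hx =>
        rw [smul_comm]
        exact Submodule.smul_mem _ c hx
  have h0 := key s.r
  rw [s.pow_eq] at h0
  have h1 : (radSub (⊥ : Ideal A) M : Submodule k M) = ⊥ := by
    rw [radSub, Submodule.span_eq_bot]
    rintro _ ⟨a, ha, x, rfl⟩
    rw [Ideal.mem_bot] at ha
    rw [ha, MulOpposite.op_zero, zero_smul]
  rw [h1] at h0
  exact (Submodule.subsingleton_iff k).1 (subsingleton_of_bot_eq_top h0)

variable (he : CompleteOrthogonalIdempotents e)
include he s

/-- By Nakayama `M / M J` is nonzero, so some `e_j` acts nontrivially on it. A linear form on `M`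
that kills `M J`, precomposed with the action of `e_j`, is a module map to the simple module of
`χ_j`. -/
theorem exists_charModule_hom [Nontrivial M] :
    ∃ (j : Fin n) (x : M) (p : M →ₗ[Aᵐᵒᵖ] CharModule (s.χ j)),
      op (e j) • x = x ∧ p x = (1 : k) := by
  have := s.twoSided
  have h1 : (radSub s.J M : Submodule k M) ≠ ⊤ := fun h =>
    not_subsingleton M (s.subsingleton_of_radSub_eq_top h)
  have h2 : ∃ (j : Fin n) (x : M), op (e j) • x ∉ (radSub s.J M : Submodule k M) := by
    by_contra! h
    apply h1
    rw [eq_top_iff]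
    intro x _
    have hx : x = ∑ j, op (e j) • x := by
      rw [← Finset.sum_smul, ← Finset.op_sum, he.complete, MulOpposite.op_one, one_smul]
    rw [hx]
    exact sum_mem fun j _ => h j x
  obtain ⟨j, x, hx⟩ := h2
  obtain ⟨ℓ, hℓ, hℓx⟩ := LinearMap.exists_extend_of_notMem
    (0 : (radSub s.J M : Submodule k M) →ₗ[k] k) hx 1
  have hℓJ : ∀ a ∈ s.J, ∀ y : M, ℓ (op a • y) = 0 := fun a ha y =>
    LinearMap.congr_fun hℓ ⟨op a • y, Submodule.subset_span ⟨a, ha, y, rfl⟩⟩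
  have hje : ∀ x : M, op (e j) • op (e j) • x = op (e j) • x := fun x => by
    rw [← mul_smul, ← MulOpposite.op_mul, (he.idem j).eq]
  refine ⟨j, op (e j) • x,
    { toFun := fun y => (ℓ (op (e j) • y) : k)
      map_add' := fun y z => by rw [smul_add, map_add]; rfl
      map_smul' := fun a y => ?_ }, hje x, ?_⟩
  · obtain ⟨a, rfl⟩ := op_surjective a
    change ℓ (op (e j) • op a • y) = s.χ j a * ℓ (op (e j) • y)
    -- Linearity over `A` comes from `a e_j ≡ χ_j(a) e_j` modulo `J`.
    have hmem : a * e j - s.χ j a • e j ∈ s.J := by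
      rw [s.mem_J]
      intro i
      simp only [map_sub, map_mul, s.χ_e, map_smul, smul_eq_mul]
      split_ifs with hij
      · rw [hij]; simp
      · simp
    have h3 := hℓJ _ hmem y
    have h4 : op (a * e j - s.χ j a • e j) • y = op (e j) • op a • y - s.χ j a • op (e j) • y := by
      rw [MulOpposite.op_sub, sub_smul, MulOpposite.op_mul, mul_smul, MulOpposite.op_smul,
        smul_assoc]
    rw [h4, ℓ.map_sub, ℓ.map_smul, sub_eq_zero] at h3
    exact h3
  · change ℓ (op (e j) • op (e j) • x) = 1
    rw [hje, hℓx]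

/-- A nonzero projective right module has a direct summand of the form `e_j A`. -/
theorem exists_summand [Module.Projective Aᵐᵒᵖ M] [Nontrivial M] :
    ∃ (j : Fin n) (u : M →ₗ[Aᵐᵒᵖ] A) (v : A →ₗ[Aᵐᵒᵖ] M), (∀ x, e j * u x = u x) ∧
      ∀ a, u (v a) = e j * a := by
  obtain ⟨j, x, p, hx, hp⟩ := s.exists_charModule_hom he (M := M)
  let q : A →ₗ[Aᵐᵒᵖ] CharModule (s.χ j) :=
    { toFun := fun a => (s.χ j a : k)
      map_add' := fun a b => map_add (s.χ j) a b
      map_smul' := fun b a => by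
        change s.χ j (a * unop b) = s.χ j (unop b) * s.χ j a
        rw [map_mul, mul_comm] }
  have hq : Function.Surjective q := fun c =>
    ⟨algebraMap k A (c : k), (s.χ j).commutes (c : k)⟩
  -- Projectivity lifts `p` along the map `χ_j` from `A` to its simple module, so `h x` has
  -- character value `1`.
  obtain ⟨h, hh⟩ := Module.projective_lifting_property q p hq
  have hhx : s.χ j (h x) = 1 := (LinearMap.congr_fun hh x).trans hp
  have hhe : h x * e j = h x := by
    have := h.map_smul (op (e j)) x
    rw [hx] at this
    exact this.symm
  let b := e j * h x
  have hb : b - e j ∈ s.J := by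
    rw [s.mem_J]
    intro i
    simp only [b, map_sub, map_mul, s.χ_e]
    split_ifs with hij
    · rw [hij, hhx]; simp
    · simp
  have hbe : b * e j = b := by rw [mul_assoc, hhe]
  have heb : e j * b = b := by rw [← mul_assoc, (he.idem j).eq]
  -- Since `b ≡ e_j` modulo `J`, the element `w = 1 + (b - e_j)` is a unit, and `b = e_j w`. Hence
  -- `a ↦ x w⁻¹ a` is a section of `u` over `e_j A`.
  obtain ⟨w, hw⟩ := (s.isNilpotent hb).isUnit_one_add
  have hbw : b * (↑w⁻¹ : A) = e j := by
    have h1 : b = e j * w := by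
      rw [hw, mul_add, mul_sub, heb, (he.idem j).eq, mul_one]
      abel
    rw [h1, mul_assoc, Units.mul_inv, mul_one]
  refine ⟨j, leftMul (e j) ∘ₗ h,
    { toFun := fun a => op ((↑w⁻¹ : A) * a) • x
      map_add' := fun a a' => by rw [mul_add, MulOpposite.op_add, add_smul]
      map_smul' := fun c a => by
        change op ((↑w⁻¹ : A) * (a * unop c)) • x = c • op ((↑w⁻¹ : A) * a) • x
        rw [← mul_assoc, MulOpposite.op_mul, mul_smul, op_unop] }, fun y => ?_, fun a => ?_⟩
  · simp [← mul_assoc, (he.idem j).eq]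
  · change e j * h (op ((↑w⁻¹ : A) * a) • x) = e j * a
    rw [map_smul]
    change e j * (h x * ((↑w⁻¹ : A) * a)) = e j * a
    rw [← mul_assoc, ← mul_assoc]
    change b * (↑w⁻¹ : A) * a = e j * a
    rw [hbw]

/-- A nonzero projective module splits off some `e_j A`, which contributes column `j` of the Cartan
matrix. The complement is projective of smaller dimension; `N` bounds the dimension for the
induction. -/
theorem dimVec_projective [Module.Finite k A] (N : ℕ) (M : Type u) [AddCommGroup M] [Module k M]
    [Module Aᵐᵒᵖ M] [IsScalarTower k Aᵐᵒᵖ M] [Module.Finite k M] [Module.Projective Aᵐᵒᵖ M]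
    (hN : Module.finrank k M ≤ N) :
    dimVec k e M ∈ Submodule.span ℤ (Set.range (cartanMatrix k e).col) := by
  induction N generalizing M with
  | zero =>
    have hz : dimVec k e M = 0 := by
      ext i
      have := Submodule.finrank_le (piece k M (op (e i)))
      simp only [dimVec, pieceDim, Pi.zero_apply]
      omega
    rw [hz]
    exact zero_mem _
  | succ N ih =>
    rcases subsingleton_or_nontrivial M with hM | hM
    · exact ih M (by simp [Module.finrank_zero_of_subsingleton])
    obtain ⟨j, u, v, hu, huv⟩ := s.exists_summand he (M := M)
    let K := LinearMap.ker u
    let p : M →ₗ[Aᵐᵒᵖ] LinearMap.range (leftMul (e j)) :=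
      u.codRestrict _ fun x => ⟨u x, hu x⟩
    have hp : Function.Surjective p := by
      rintro ⟨_, a, rfl⟩
      exact ⟨v a, Subtype.ext (huv a)⟩
    have hex : Function.Exact K.subtype p := by
      intro x
      rw [Submodule.coe_subtype, Subtype.range_coe]
      exact Subtype.ext_iff
    have hproj : Module.Projective Aᵐᵒᵖ K := by
      -- The map `id - v u` retracts `M` onto the kernel of `u`, because `u v u = e_j u = u`.
      refine Module.Projective.of_split K.subtype
        ((LinearMap.id - v ∘ₗ u).codRestrict K fun x => by simp [K, huv, hu]) (LinearMap.ext ?_)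
      rintro ⟨x, hx⟩
      have : u x = 0 := hx
      apply Subtype.ext
      simp [this]
    have hfin : Module.Finite k K :=
      Module.Finite.of_injective (K.subtype.restrictScalars k) (Submodule.injective_subtype _)
    have hadd : dimVec k e M = dimVec k e K + (cartanMatrix k e).col j := by
      ext i
      refine (pieceDim_of_exact k (e := op (e i)) ?_ K.subtype p (Submodule.injective_subtype _)
        hp hex).trans ?_
      · rw [IsIdempotentElem, ← MulOpposite.op_mul, (he.idem i).eq]
      · rw [pieceDim_range_leftMul]
        rfl
    -- If the kernel were everything, `u (v 1) = e_j` would vanish, contradicting `χ_j(e_j) = 1`.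
    have hlt : Module.finrank k K < Module.finrank k M := by
      refine lt_of_le_of_ne (LinearMap.finrank_le_finrank_of_injective
        (f := K.subtype.restrictScalars k) (Submodule.injective_subtype _)) fun heq => ?_
      have hs : Function.Surjective (K.subtype.restrictScalars k) :=
        (LinearMap.injective_iff_surjective_of_finrank_eq_finrank heq).1
          (Submodule.injective_subtype _)
      obtain ⟨⟨y, hy⟩, hy'⟩ := hs (v 1)
      have h0 : u (v 1) = 0 := by rw [← hy']; exact hy
      rw [huv, mul_one] at h0
      have := s.χ_e j j
      rw [h0, map_zero, if_pos rfl] at this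
      exact zero_ne_one this
    rw [hadd]
    exact add_mem (ih K (by omega)) (Submodule.subset_span ⟨j, rfl⟩)

/-- Dimension vectors are additive on short exact sequences, so the statement passes from
projectives to cokernels along a finite resolution. -/
theorem dimVec_of_hasFiniteResolution [Module.Finite k A] {M : ModuleCat.{u} Aᵐᵒᵖ}
    (h : HasFiniteResolution IsFinProj M) :
    dimVecObj k e M ∈ Submodule.span ℤ (Set.range (cartanMatrix k e).col) := by
  have hfin : ∀ P : ModuleCat.{u} Aᵐᵒᵖ, IsFinProj P → Module.Finite k P := fun P hP =>
    fin_of_isFinProj (modTrace k (0 : Aᵐᵒᵖ)) (𝟭 _) (modTrace_fin_of 0) hP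
  induction h with
  | @base M h =>
    have := hfin M h
    have : Module.Projective Aᵐᵒᵖ M := (IsProjective.iff_projective (R := Aᵐᵒᵖ) M).2 h.projective
    exact s.dimVec_projective he _ M le_rfl
  | @step S hS h₂ h₁ ih =>
    have := hfin _ h₂
    have : Module.Projective Aᵐᵒᵖ S.X₂ :=
      (IsProjective.iff_projective (R := Aᵐᵒᵖ) S.X₂).2 h₂.projective
    have h2 := s.dimVec_projective he _ S.X₂ le_rfl
    have hadd : dimVecObj k e S.X₃ = dimVecObj k e S.X₂ - dimVecObj k e S.X₁ := by
      rw [eq_sub_iff_add_eq, add_comm]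
      ext i
      refine (pieceDim_of_exact k (e := op (e i)) ?_ S.f.hom S.g.hom hS.moduleCat_injective_f
        hS.moduleCat_surjective_g
        ((ShortComplex.ShortExact.moduleCat_exact_iff_function_exact S).1 hS.exact)).symm
      rw [IsIdempotentElem, ← MulOpposite.op_mul, (he.idem i).eq]
    rw [hadd]
    exact Submodule.sub_mem _ h2 ih

omit s he in
theorem _root_.Lefschetz.HasFiniteGlobalDimension.hasFiniteResolution [Module.Finite k A]
    (hgl : HasFiniteGlobalDimension A) [Module.Finite k M] :
    HasFiniteResolution IsFinProj (ModuleCat.of Aᵐᵒᵖ M) := by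
  obtain ⟨d, hd⟩ := hgl
  have : IsNoetherianRing Aᵐᵒᵖ := IsNoetherianRing.of_finite k Aᵐᵒᵖ
  have : Module.Finite Aᵐᵒᵖ M := Module.Finite.of_restrictScalars_finite k Aᵐᵒᵖ M
  exact hasFiniteResolution_of_projectiveDimension d _ (hd _)

/-- The Cartan matrix is invertible over the integers. -/
theorem isUnit_cartanMatrix [Module.Finite k A] (hgl : HasFiniteGlobalDimension A) :
    IsUnit (cartanMatrix k e) := by
  -- The simple module of `χ_j` has the standard basis vector `j` as dimension vector; hence the
  -- columns span `ℤ^n`, and multiplication by the matrix is surjective.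
  have hspan : Submodule.span ℤ (Set.range (cartanMatrix k e).col) = ⊤ := by
    rw [eq_top_iff, ← (Pi.basisFun ℤ (Fin n)).span_eq, Submodule.span_le]
    rintro _ ⟨j, rfl⟩
    have h := s.dimVec_of_hasFiniteResolution he
      (hgl.hasFiniteResolution (k := k) (M := CharModule (s.χ j)))
    have hd : dimVecObj k e (ModuleCat.of Aᵐᵒᵖ (CharModule (s.χ j))) =
        Pi.basisFun ℤ (Fin n) j := by
      ext i
      rw [dimVecObj_of, dimVec, CharModule.pieceDim_eq _ _ (s.χ_e j i)]
      by_cases hij : j = i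
      · subst hij; simp
      · simp [hij]
    rw [hd] at h
    exact h
  rw [← Matrix.range_mulVecLin, LinearMap.range_eq_top] at hspan
  exact Matrix.mulVec_surjective_iff_isUnit.1 hspan

end Splitting

end CartanMatrix

/-! ### Duality and left modules -/

section Duality

variable {k A : Type u} [Field k] [Ring A] [Algebra k A]

/-- The right module dual to a left module. -/
def RightDual (k : Type u) [Field k] (X : Type u) [AddCommGroup X] [Module k X] : Type u :=
  X →ₗ[k] k

namespace RightDual

section

variable {X : Type u} [AddCommGroup X] [Module k X]

instance : AddCommGroup (RightDual k X) := inferInstanceAs (AddCommGroup (X →ₗ[k] k))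
instance : FunLike (RightDual k X) X k := inferInstanceAs (FunLike (X →ₗ[k] k) X k)
instance : LinearMapClass (RightDual k X) k X k :=
  inferInstanceAs (LinearMapClass (X →ₗ[k] k) k X k)

@[ext]
theorem ext {f g : RightDual k X} (h : ∀ x, f x = g x) : f = g := LinearMap.ext h

@[simp]
theorem add_apply (f g : RightDual k X) (x : X) : (f + g) x = f x + g x := rfl

variable [Module A X] [IsScalarTower k A X]

instance : Module Aᵐᵒᵖ (RightDual k X) where
  smul a f := LinearMap.comp f (Algebra.lsmul k k X (unop a))
  one_smul f := ext fun x => congrArg f (one_smul A x)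
  mul_smul a b f := ext fun x => congrArg f (mul_smul (unop b) (unop a) x)
  smul_zero _ := rfl
  smul_add _ _ _ := rfl
  add_smul a b f := ext fun x =>
    (congrArg f (add_smul (unop a) (unop b) x)).trans (map_add f _ _)
  zero_smul f := ext fun x => (congrArg f (zero_smul A x)).trans (map_zero f)

@[simp]
theorem smul_apply (a : Aᵐᵒᵖ) (f : RightDual k X) (x : X) : (a • f) x = f (unop a • x) := rfl

variable {Y : Type u} [AddCommGroup Y] [Module k Y] [Module A Y] [IsScalarTower k A Y]

/-- The transpose of a linear map. -/
def map (g : X →ₗ[A] Y) : RightDual k Y →ₗ[Aᵐᵒᵖ] RightDual k X where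
  toFun f := LinearMap.comp f (g.restrictScalars k)
  map_add' _ _ := rfl
  map_smul' a f := ext fun x => congrArg f (g.map_smul (unop a) x).symm

theorem map_injective {g : X →ₗ[A] Y} (hg : Function.Surjective g) :
    Function.Injective (map (k := k) g) := by
  intro f f' h
  ext y
  obtain ⟨x, rfl⟩ := hg y
  exact DFunLike.congr_fun h x

theorem map_surjective {g : X →ₗ[A] Y} (hg : Function.Injective g) :
    Function.Surjective (map (k := k) g) := by
  intro f
  obtain ⟨ρ, hρ⟩ := (g.restrictScalars k).exists_leftInverse_of_injective
    (LinearMap.ker_eq_bot.2 hg)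
  refine ⟨LinearMap.comp f ρ, ext fun x => ?_⟩
  exact congrArg f (LinearMap.congr_fun hρ x)

end

/-- A module map `U → D(A^m)` amounts to `m` linear forms on `U`, its values on the basis of `A^m`.
Over a field these forms extend to `V` through a linear retraction `ρ`, which need not be
`A`-linear. -/
instance injective_free (m : ℕ) :
    Injective (ModuleCat.of Aᵐᵒᵖ (RightDual k (Fin m → A))) where
  factors {U V} f i hi := by
    have hinj : Function.Injective i.hom := (ModuleCat.mono_iff_injective _).1 hi
    obtain ⟨ρ, hρ⟩ := (i.hom.restrictScalars k).exists_leftInverse_of_injective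
      (LinearMap.ker_eq_bot.2 hinj)
    have hsm : ∀ (c : k) (v : V), c • v = algebraMap k Aᵐᵒᵖ c • v := fun c v =>
      (algebraMap_smul Aᵐᵒᵖ c v).symm
    let F : U →ₗ[Aᵐᵒᵖ] RightDual k (Fin m → A) := f.hom
    let φ : Fin m → U →ₗ[k] k := fun c =>
      { toFun := fun x => F x (Pi.single c 1)
        map_add' := fun x y => by rw [map_add, add_apply]
        map_smul' := fun a x => by
          rw [← algebraMap_smul Aᵐᵒᵖ a x, map_smul, smul_apply, RingHom.id_apply]
          have : (unop (algebraMap k Aᵐᵒᵖ a) : A) • (Pi.single c 1 : Fin m → A) =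
              a • Pi.single c 1 := by
            rw [MulOpposite.algebraMap_apply, unop_op, algebraMap_smul]
          rw [this, map_smul] }
    let G : V →ₗ[Aᵐᵒᵖ] RightDual k (Fin m → A) :=
      { toFun := fun v => (show (Fin m → A) →ₗ[k] k from
          { toFun := fun b => ∑ c, φ c (ρ (op (b c) • v))
            map_add' := fun b b' => by
              simp [add_smul, Finset.sum_add_distrib]
            map_smul' := fun a b => by
              simp [Finset.mul_sum] })
        map_add' := fun v w => ext fun b => by
          change ∑ c, φ c (ρ (op (b c) • (v + w))) =
            ∑ c, φ c (ρ (op (b c) • v)) + ∑ c, φ c (ρ (op (b c) • w))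
          simp [Finset.sum_add_distrib]
        map_smul' := fun a v => ext fun b => by
          change ∑ c, φ c (ρ (op (b c) • a • v)) = ∑ c, φ c (ρ (op (unop a * b c) • v))
          simp [mul_smul] }
    refine ⟨ModuleCat.ofHom G, ModuleCat.hom_ext (LinearMap.ext fun x => ext fun b => ?_)⟩
    change ∑ c, φ c (ρ (op (b c) • i.hom x)) = F x b
    have h1 : ∀ y : U, ρ (i.hom y) = y := LinearMap.congr_fun hρ
    simp only [← map_smul i.hom, h1]
    change ∑ c, F (op (b c) • x) (Pi.single c 1) = F x b
    simp only [map_smul, smul_apply, unop_op, ← map_sum]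
    congr 1
    ext d
    simp [Finset.sum_apply, Pi.single_apply]

/-- A finite dimensional left module with injective dual is projective. -/
theorem isFinProj_of_injective [Module.Finite k A] (X : Type u) [AddCommGroup X] [Module k X]
    [Module A X] [IsScalarTower k A X] [Module.Finite k X]
    [hX : Injective (ModuleCat.of Aᵐᵒᵖ (RightDual k X))] : IsFinProj (ModuleCat.of A X) := by
  have : Module.Finite A X := Module.Finite.of_restrictScalars_finite k A X
  obtain ⟨m, p, hp⟩ := Module.Finite.exists_fin' A X
  have hm : Mono (ModuleCat.ofHom (map (k := k) p)) :=
    (ModuleCat.mono_iff_injective _).2 (map_injective hp)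
  let ρ := (Injective.factorThru (𝟙 (ModuleCat.of Aᵐᵒᵖ (RightDual k X)))
    (ModuleCat.ofHom (map (k := k) p))).hom
  have hρ : ∀ f : RightDual k X, ρ (map p f) = f := fun f =>
    LinearMap.congr_fun (congrArg ModuleCat.Hom.hom (Injective.comp_factorThru
      (𝟙 (ModuleCat.of Aᵐᵒᵖ (RightDual k X))) (ModuleCat.ofHom (map (k := k) p)))) f
  have hρk : ∀ (c : k) (f : (Fin m → A) →ₗ[k] k) (x : X),
      ρ (c • f : (Fin m → A) →ₗ[k] k) x = c * ρ f x := by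
    intro c f x
    have h1 : (c • f : (Fin m → A) →ₗ[k] k) =
        (algebraMap k Aᵐᵒᵖ c • @id (RightDual k (Fin m → A)) f : RightDual k (Fin m → A)) := by
      apply ext (k := k)
      intro y
      rw [smul_apply, MulOpposite.algebraMap_apply, unop_op, algebraMap_smul, map_smul]
      rfl
    rw [h1, map_smul, smul_apply, MulOpposite.algebraMap_apply, unop_op, algebraMap_smul, map_smul,
      smul_eq_mul]
    rfl
  let ev : X → Module.Dual k (Module.Dual k (Fin m → A)) := fun x =>
    { toFun := fun f => ρ f x
      map_add' := fun f g => by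
        have : ρ (f + g : (Fin m → A) →ₗ[k] k) = ρ f + ρ g := map_add ρ f g
        rw [this, add_apply]
      map_smul' := fun c f => hρk c f x }
  -- Dualizing the retraction `ρ` gives a map from `X` to the double dual of `A^m`. Finite
  -- dimensionality brings it back to `A^m`, where it is a section of `p`.
  let σ : X → (Fin m → A) := fun x => (Module.evalEquiv k (Fin m → A)).symm (ev x)
  have hσ : ∀ (f : Module.Dual k (Fin m → A)) (x : X), f (σ x) = ρ f x := fun f x =>
    Module.apply_evalEquiv_symm_apply k (Fin m → A) f (ev x)
  have hsep : ∀ {y z : Fin m → A}, (∀ f : Module.Dual k (Fin m → A), f y = f z) → y = z := by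
    intro y z h
    rw [← sub_eq_zero, ← Module.forall_dual_apply_eq_zero_iff k]
    intro f
    rw [map_sub, h, sub_self]
  let σ' : X →ₗ[A] (Fin m → A) :=
    { toFun := σ
      map_add' := fun x y => hsep fun f => by
        rw [map_add, hσ, hσ, hσ]
        exact map_add (ρ f) x y
      map_smul' := fun a x => hsep fun f => by
        have h1 : f (a • σ x) = (op a • @id (RightDual k (Fin m → A)) f : RightDual k _) (σ x) := rfl
        rw [RingHom.id_apply, h1, hσ]
        refine Eq.trans ?_ (hσ (op a • @id (RightDual k (Fin m → A)) f : RightDual k _) x).symm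
        have h2 : ρ (op a • @id (RightDual k (Fin m → A)) f : RightDual k _) = op a • ρ f :=
          map_smul ρ _ _
        rw [h2]
        rfl }
  have hpσ : p ∘ₗ σ' = LinearMap.id := by
    ext x
    change p (σ x) = x
    rw [← sub_eq_zero, ← Module.forall_dual_apply_eq_zero_iff k]
    intro f
    have h1 : f (p (σ x)) = ρ (map p (f : RightDual k X)) x := hσ (f ∘ₗ p.restrictScalars k) x
    rw [map_sub, sub_eq_zero]
    exact h1.trans (DFunLike.congr_fun (hρ f) x)
  have : Module.Projective A X := Module.Projective.of_split σ' p hpσ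
  exact isFinProj_of_finite X

/-- The dual of `0 → K → A^m → X → 0` is `0 → DX → D(A^m) → DK → 0` with injective middle term, so
the injective dimension bound drops by one at each syzygy. At zero, `DX` injective forces `X`
projective. -/
theorem hasFiniteResolution_of_injectiveDimension [Module.Finite k A] (d : ℕ) (X : Type u)
    [AddCommGroup X] [Module k X] [Module A X] [IsScalarTower k A X] [Module.Finite k X]
    (h : HasInjectiveDimensionLT (ModuleCat.of Aᵐᵒᵖ (RightDual k X)) (d + 1)) :
    HasFiniteResolution IsFinProj (ModuleCat.of A X) := by
  induction d generalizing X with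
  | zero =>
    have : Injective (ModuleCat.of Aᵐᵒᵖ (RightDual k X)) := inferInstance
    exact .base (isFinProj_of_injective (k := k) X)
  | succ d ih =>
    have : Module.Finite A X := Module.Finite.of_restrictScalars_finite k A X
    obtain ⟨m, p, hp⟩ := Module.Finite.exists_fin' A X
    let K := LinearMap.ker p
    have hK : Module.Finite k K :=
      Module.Finite.of_injective (K.subtype.restrictScalars k) K.injective_subtype
    let S : ShortComplex (ModuleCat.{u} A) :=
      ShortComplex.mk (X₃ := ModuleCat.of A X) (ModuleCat.ofHom K.subtype) (ModuleCat.ofHom p)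
        (by ext x; exact x.2)
    have hS : S.ShortExact :=
      { exact := (ShortComplex.moduleCat_exact_iff S).2 fun x hx => ⟨⟨x, hx⟩, rfl⟩
        mono_f := (ModuleCat.mono_iff_injective _).2 K.injective_subtype
        epi_g := (ModuleCat.epi_iff_surjective _).2 hp }
    let S' : ShortComplex (ModuleCat.{u} Aᵐᵒᵖ) :=
      ShortComplex.mk (ModuleCat.ofHom (map (k := k) p))
        (ModuleCat.ofHom (map (k := k) K.subtype)) (by
          ext f x
          change (show RightDual k X from f) (p x) = 0
          rw [show p x = 0 from x.2, map_zero])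
    have hS' : S'.ShortExact :=
      { exact := (ShortComplex.moduleCat_exact_iff S').2 fun f hf => by
          have hf' : ∀ x ∈ LinearMap.ker (p.restrictScalars k),
              (show (Fin m → A) →ₗ[k] k from f) x = 0 := fun x hx =>
            DFunLike.congr_fun (hf : map K.subtype (show RightDual k _ from f) = 0) ⟨x, hx⟩
          obtain ⟨g, hg⟩ := LinearMap.range_dualMap_eq_dualAnnihilator_ker
            (p.restrictScalars k) ▸ (Submodule.mem_dualAnnihilator _).2 hf'
          exact ⟨g, hg⟩
        mono_f := (ModuleCat.mono_iff_injective _).2 (map_injective hp)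
        epi_g := (ModuleCat.epi_iff_surjective _).2 (map_surjective K.injective_subtype) }
    have hinj : Injective S'.X₂ := injective_free m
    have h3 : HasInjectiveDimensionLT S'.X₃ (d + 1) :=
      hS'.hasInjectiveDimensionLT_X₃ (d + 1)
        (hasInjectiveDimensionLT_of_ge _ 1 _ (by omega)) h
    exact .step hS (isFinProj_of_finite (Fin m → A)) (ih K h3)

end RightDual

/-- The bound on projective dimensions of right modules kills `Ext^i(Y, DX)` for every `Y` and `i >
d`, so it also bounds the injective dimension of `DX`. -/
theorem HasFiniteGlobalDimension.hasFiniteResolution_left (k : Type u) [Field k] [Algebra k A]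
    [Module.Finite k A] (hgl : HasFiniteGlobalDimension A) (X : Type u) [AddCommGroup X]
    [Module k X] [Module A X] [IsScalarTower k A X] [Module.Finite k X] :
    HasFiniteResolution IsFinProj (ModuleCat.of A X) := by
  obtain ⟨d, hd⟩ := hgl
  refine RightDual.hasFiniteResolution_of_injectiveDimension (k := k) d X ?_
  let := HasExt.standard (ModuleCat.{u} Aᵐᵒᵖ)
  exact HasInjectiveDimensionLT.mk fun i hi Y e =>
    have := hd Y
    e.eq_zero_of_hasProjectiveDimensionLT (d + 1) hi

end Duality

/-! ### Objects of finite projective dimension -/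

section FiniteProjectiveDimension

variable {C : Type*} [Category* C] [Abelian C]

/-- Finite projective dimension. -/
def HasFiniteProjectiveDimension (X : C) : Prop :=
  ∃ d : ℕ, HasProjectiveDimensionLT X d

namespace HasFiniteProjectiveDimension

theorem X₂ {S : ShortComplex C} (hS : S.ShortExact) (h₁ : HasFiniteProjectiveDimension S.X₁)
    (h₃ : HasFiniteProjectiveDimension S.X₃) : HasFiniteProjectiveDimension S.X₂ := by
  obtain ⟨a, ha⟩ := h₁
  obtain ⟨b, hb⟩ := h₃
  exact ⟨a + b, hS.hasProjectiveDimensionLT_X₂ _ inferInstance inferInstance⟩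

theorem X₃ {S : ShortComplex C} (hS : S.ShortExact) (h₁ : HasFiniteProjectiveDimension S.X₁)
    (h₂ : HasFiniteProjectiveDimension S.X₂) : HasFiniteProjectiveDimension S.X₃ := by
  obtain ⟨a, ha⟩ := h₁
  obtain ⟨b, hb⟩ := h₂
  refine ⟨a + b + 1, hS.hasProjectiveDimensionLT_X₃ _ inferInstance ?_⟩
  exact hasProjectiveDimensionLT_of_ge _ b _ (by omega)

/-- An Ext class `x` on `X` is the sum of the composites of `f_a ≫ s_a` with `x`, and each passes
through an Ext group of `Q a`. The sum of the `d a` merely serves as a common upper bound. -/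
theorem of_sum_eq_id {X : C} {m : ℕ} {Q : Fin m → C} (f : ∀ a, X ⟶ Q a) (s : ∀ a, Q a ⟶ X)
    (h : ∑ a, f a ≫ s a = 𝟙 X) (hQ : ∀ a, HasFiniteProjectiveDimension (Q a)) :
    HasFiniteProjectiveDimension X := by
  choose d hd using hQ
  refine ⟨∑ a, d a, ?_⟩
  let := HasExt.standard C
  rw [hasProjectiveDimensionLT_iff]
  intro i hi T x
  have hz : ∀ a, (Abelian.Ext.mk₀ (f a ≫ s a)).comp x (zero_add i) = 0 := fun a => by
    rw [← Abelian.Ext.mk₀_comp_mk₀, Abelian.Ext.comp_assoc_of_second_deg_zero,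
      ((Abelian.Ext.mk₀ (s a)).comp x (zero_add i)).eq_zero_of_hasProjectiveDimensionLT (d a)
        ((Finset.single_le_sum (fun _ _ => Nat.zero_le _) (Finset.mem_univ a)).trans hi),
      Abelian.Ext.comp_zero]
  rw [← x.mk₀_id_comp, ← h, Abelian.Ext.mk₀_sum, Abelian.Ext.sum_comp]
  exact Finset.sum_eq_zero fun a _ => hz a

theorem of_hasFiniteResolution {R : Type u} [Ring R] (F : ModuleCat.{u} R ⥤ C) [F.Additive]
    (hF : ∀ S : ShortComplex (ModuleCat.{u} R), S.ShortExact → (S.map F).ShortExact)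
    (hR : HasFiniteProjectiveDimension (F.obj (regular R))) {M : ModuleCat.{u} R}
    (hM : HasFiniteResolution IsFinProj M) : HasFiniteProjectiveDimension (F.obj M) := by
  have h0 : ∀ P, IsFinProj P → HasFiniteProjectiveDimension (F.obj P) := by
    rintro P ⟨m, f, s, h⟩
    exact of_sum_eq_id (fun a => F.map (f a)) (fun a => F.map (s a))
      (F.sum_map_comp_map_eq_id h) fun _ => hR
  induction hM with
  | base h => exact h0 _ h
  | step hS h₂ h₁ ih => exact X₃ (hF _ hS) ih (h0 _ h₂)

theorem of_submodule {R : Type u} [Ring R] {M : Type u} [AddCommGroup M] [Module R M]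
    (N : Submodule R M) (h₁ : HasFiniteProjectiveDimension (ModuleCat.of R N))
    (h₃ : HasFiniteProjectiveDimension (ModuleCat.of R (M ⧸ N))) :
    HasFiniteProjectiveDimension (ModuleCat.of R M) := by
  let S : ShortComplex (ModuleCat.{u} R) :=
    ShortComplex.mk (ModuleCat.ofHom N.subtype) (ModuleCat.ofHom N.mkQ)
      (ModuleCat.hom_ext (LinearMap.ext fun x => (Submodule.Quotient.mk_eq_zero N).2 x.2))
  have hS : S.ShortExact :=
    { exact := (ShortComplex.ShortExact.moduleCat_exact_iff_function_exact S).2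
        (LinearMap.exact_subtype_mkQ N)
      mono_f := (ModuleCat.mono_iff_injective _).2 N.injective_subtype
      epi_g := (ModuleCat.epi_iff_surjective _).2 N.mkQ_surjective }
  exact X₂ hS h₁ h₃

end HasFiniteProjectiveDimension

end FiniteProjectiveDimension

/-! ### Modules over the opposite of the enveloping algebra -/

section Outer

variable {k A : Type u} [Field k] [Ring A] [Algebra k A]

/-- An additive map that commutes with the pure tensors is linear over the enveloping algebra. -/
def envLinear {P Q : Type*} [AddCommGroup P] [Module (Env k A)ᵐᵒᵖ P] [AddCommGroup Q]
    [Module (Env k A)ᵐᵒᵖ Q] (f : P →+ Q)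
    (h : ∀ (a : Aᵐᵒᵖ) (b : A) (x : P),
      f (op (a ⊗ₜ[k] b : Env k A) • x) = op (a ⊗ₜ[k] b : Env k A) • f x) :
    P →ₗ[(Env k A)ᵐᵒᵖ] Q where
  toFun := f
  map_add' := f.map_add
  map_smul' r x := by
    obtain ⟨r, rfl⟩ := op_surjective r
    simp only [RingHom.id_apply]
    induction r using TensorProduct.induction_on with
    | zero =>
      exact (congrArg f (zero_smul (Env k A)ᵐᵒᵖ x)).trans
        (f.map_zero.trans (zero_smul (Env k A)ᵐᵒᵖ (f x)).symm)
    | tmul a b => exact h a b x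
    | add r s hr hs => rw [MulOpposite.op_add, add_smul, add_smul, map_add, hr, hs]

variable (k) in
/-- The outer tensor product of a left and a right module, a right module over the enveloping
algebra. -/
def Outer (X Y : Type u) [AddCommGroup X] [Module k X] [AddCommGroup Y] [Module k Y] : Type u :=
  X ⊗[k] Y

namespace Outer

section

variable (X Y : Type u) [AddCommGroup X] [Module k X] [AddCommGroup Y] [Module k Y]

instance : AddCommGroup (Outer k X Y) := inferInstanceAs (AddCommGroup (X ⊗[k] Y))
instance : Module k (Outer k X Y) := inferInstanceAs (Module k (X ⊗[k] Y))

variable {X Y} in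
/-- Pure tensors. -/
def tmul (x : X) (y : Y) : Outer k X Y := x ⊗ₜ[k] y

variable (A) [Module A X] [IsScalarTower k A X] [Module Aᵐᵒᵖ Y] [IsScalarTower k Aᵐᵒᵖ Y]

/-- The action of the enveloping algebra on an outer tensor product. -/
def actionHom : (Env k A)ᵐᵒᵖ →ₐ[k] Module.End k (X ⊗[k] Y) :=
  AlgHom.opComm (Algebra.TensorProduct.lift
    (AlgHom.op ((Module.End.rTensorAlgHom k X Y).comp (Algebra.lsmul k k X : A →ₐ[k] Module.End k X)))
    (AlgHom.opComm.symm
      ((Module.End.lTensorAlgHom k Y X).comp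
        (Algebra.lsmul k k Y : Aᵐᵒᵖ →ₐ[k] Module.End k Y)))
    (fun a b => by
      apply MulOpposite.unop_injective
      apply TensorProduct.ext'
      intro x y
      rfl))

theorem actionHom_tmul (a : Aᵐᵒᵖ) (b : A) (x : X) (y : Y) :
    actionHom A X Y (op (a ⊗ₜ[k] b)) (x ⊗ₜ[k] y) = (unop a • x) ⊗ₜ[k] (op b • y) := by
  simp [actionHom, AlgHom.opComm]
  rfl

instance : Module (Env k A)ᵐᵒᵖ (Outer k X Y) :=
  Module.compHom (X ⊗[k] Y) (actionHom A X Y).toRingHom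

theorem smul_tmul (a : Aᵐᵒᵖ) (b : A) (x : X) (y : Y) :
    op (a ⊗ₜ[k] b : Env k A) • (tmul x y : Outer k X Y) = tmul (unop a • x) (op b • y) :=
  actionHom_tmul A X Y a b x y

end

variable {X X' Y Y' : Type u} [AddCommGroup X] [Module k X] [AddCommGroup Y] [Module k Y]
  [AddCommGroup X'] [Module k X'] [AddCommGroup Y'] [Module k Y']

@[elab_as_elim]
theorem induction {P : Outer k X Y → Prop} (t : Outer k X Y) (zero : P 0)
    (tm : ∀ x y, P (tmul x y)) (add : ∀ s t, P s → P t → P (s + t)) : P t :=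
  TensorProduct.induction_on t zero tm add

variable [Module A X] [IsScalarTower k A X] [Module Aᵐᵒᵖ Y] [IsScalarTower k Aᵐᵒᵖ Y]
  [Module A X'] [IsScalarTower k A X'] [Module Aᵐᵒᵖ Y'] [IsScalarTower k Aᵐᵒᵖ Y']

/-- Linear maps out of an outer tensor product. -/
def lift {Q : Type*} [AddCommGroup Q] [Module k Q] [Module (Env k A)ᵐᵒᵖ Q]
    (f : X ⊗[k] Y →ₗ[k] Q)
    (h : ∀ (a : Aᵐᵒᵖ) (b : A) (x : X) (y : Y),
      f ((unop a • x) ⊗ₜ[k] (op b • y)) = op (a ⊗ₜ[k] b : Env k A) • f (x ⊗ₜ[k] y)) :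
    Outer k X Y →ₗ[(Env k A)ᵐᵒᵖ] Q :=
  let f' : Outer k X Y →+ Q := f.toAddMonoidHom
  envLinear f' fun a b t => by
    induction t using Outer.induction with
    | zero => rw [smul_zero, map_zero, smul_zero]
    | tm x y =>
      rw [smul_tmul]
      exact h a b x y
    | add s t hs ht => rw [smul_add, map_add, hs, ht, map_add, smul_add]

/-- Functoriality of the outer tensor product. -/
def map (f : X →ₗ[A] X') (g : Y →ₗ[Aᵐᵒᵖ] Y') : Outer k X Y →ₗ[(Env k A)ᵐᵒᵖ] Outer k X' Y' :=
  lift (Q := Outer k X' Y') (TensorProduct.map (f.restrictScalars k) (g.restrictScalars k))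
    fun a b x y => by
      refine Eq.trans ?_ (smul_tmul A X' Y' a b (f x) (g y)).symm
      rw [← map_smul, ← map_smul]
      rfl

theorem hom_ext {Q : Type*} [AddCommGroup Q] [Module (Env k A)ᵐᵒᵖ Q]
    {f g : Outer k X Y →ₗ[(Env k A)ᵐᵒᵖ] Q} (h : ∀ x y, f (tmul x y) = g (tmul x y)) : f = g := by
  ext t
  induction t using Outer.induction with
  | zero => simp
  | tm x y => exact h x y
  | add s t hs ht => rw [map_add, map_add, hs, ht]

/-- The outer tensor product of the regular modules is the regular module. -/
def regularEquiv (u : X ≃ₗ[A] A) (v : Y ≃ₗ[Aᵐᵒᵖ] Aᵐᵒᵖ) :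
    Outer k X Y ≃ₗ[(Env k A)ᵐᵒᵖ] (Env k A)ᵐᵒᵖ :=
  let E : X ⊗[k] Y ≃ₗ[k] (Env k A)ᵐᵒᵖ :=
    (TensorProduct.congr (u.restrictScalars k ≪≫ₗ opLinearEquiv k)
      (v.restrictScalars k ≪≫ₗ (opLinearEquiv k).symm)) ≪≫ₗ opLinearEquiv k
  { E with
    map_smul' := (lift E.toLinearMap fun a b x y => by
      change op (op (u (unop a • x)) ⊗ₜ[k] unop (v (op b • y))) =
        op ((op (u x) ⊗ₜ[k] unop (v y)) * (a ⊗ₜ[k] b))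
      rw [map_smul, map_smul, Algebra.TensorProduct.tmul_mul_tmul]
      rfl).map_smul' }

end Outer

variable (k) in
/-- The functor `X ↦ X ⊗ Y` from left modules. -/
def outerLeft (Y : ModuleCat.{u} Aᵐᵒᵖ) : ModuleCat.{u} A ⥤ ModuleCat.{u} (Env k A)ᵐᵒᵖ where
  obj X := ModuleCat.of _ (Outer k X Y)
  map f := ModuleCat.ofHom (Outer.map f.hom LinearMap.id)
  map_id _ := ModuleCat.hom_ext (Outer.hom_ext fun _ _ => rfl)
  map_comp _ _ := ModuleCat.hom_ext (Outer.hom_ext fun _ _ => rfl)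

variable (k) in
/-- The functor `Y ↦ X ⊗ Y` from right modules. -/
def outerRight (X : ModuleCat.{u} A) : ModuleCat.{u} Aᵐᵒᵖ ⥤ ModuleCat.{u} (Env k A)ᵐᵒᵖ where
  obj Y := ModuleCat.of _ (Outer k X Y)
  map f := ModuleCat.ofHom (Outer.map LinearMap.id f.hom)
  map_id _ := ModuleCat.hom_ext (Outer.hom_ext fun _ _ => rfl)
  map_comp _ _ := ModuleCat.hom_ext (Outer.hom_ext fun _ _ => rfl)

instance (Y : ModuleCat.{u} Aᵐᵒᵖ) : (outerLeft k Y).Additive where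
  map_add {_ _} {f g} := ModuleCat.hom_ext (Outer.hom_ext fun x y =>
    TensorProduct.add_tmul (f.hom x) (g.hom x) y)

instance (X : ModuleCat.{u} A) : (outerRight k X).Additive where
  map_add {_ _} {f g} := ModuleCat.hom_ext (Outer.hom_ext fun x y =>
    TensorProduct.tmul_add x (f.hom y) (g.hom y))

theorem outerLeft_shortExact (Y : ModuleCat.{u} Aᵐᵒᵖ) (S : ShortComplex (ModuleCat.{u} A))
    (hS : S.ShortExact) : (S.map (outerLeft k Y)).ShortExact := by
  have hex := (ShortComplex.ShortExact.moduleCat_exact_iff_function_exact S).1 hS.exact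
  exact
    { exact := (ShortComplex.ShortExact.moduleCat_exact_iff_function_exact _).2
        (rTensor_exact Y (f := S.f.hom.restrictScalars k) (g := S.g.hom.restrictScalars k) hex
          hS.moduleCat_surjective_g)
      mono_f := (ModuleCat.mono_iff_injective _).2
        (Module.Flat.rTensor_preserves_injective_linearMap (M := Y)
          (S.f.hom.restrictScalars k) hS.moduleCat_injective_f)
      epi_g := (ModuleCat.epi_iff_surjective _).2
        (LinearMap.rTensor_surjective Y (g := S.g.hom.restrictScalars k)
          hS.moduleCat_surjective_g) }

theorem outerRight_shortExact (X : ModuleCat.{u} A) (S : ShortComplex (ModuleCat.{u} Aᵐᵒᵖ))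
    (hS : S.ShortExact) : (S.map (outerRight k X)).ShortExact := by
  have hex := (ShortComplex.ShortExact.moduleCat_exact_iff_function_exact S).1 hS.exact
  exact
    { exact := (ShortComplex.ShortExact.moduleCat_exact_iff_function_exact _).2
        (lTensor_exact X (f := S.f.hom.restrictScalars k) (g := S.g.hom.restrictScalars k) hex
          hS.moduleCat_surjective_g)
      mono_f := (ModuleCat.mono_iff_injective _).2
        (Module.Flat.lTensor_preserves_injective_linearMap (M := X)
          (S.f.hom.restrictScalars k) hS.moduleCat_injective_f)
      epi_g := (ModuleCat.epi_iff_surjective _).2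
        (LinearMap.lTensor_surjective X (g := S.g.hom.restrictScalars k)
          hS.moduleCat_surjective_g) }

/-- The `k`-structures are implicit arguments so that they can be those carried by objects of the
module categories. -/
theorem hasFiniteProjectiveDimension_outer_of_equiv {X Y : Type u} [AddCommGroup X]
    {iX : Module k X} [Module A X] {_ : IsScalarTower k A X} [AddCommGroup Y] {iY : Module k Y}
    [Module Aᵐᵒᵖ Y] {_ : IsScalarTower k Aᵐᵒᵖ Y} (u : X ≃ₗ[A] A) (v : Y ≃ₗ[Aᵐᵒᵖ] Aᵐᵒᵖ) :
    HasFiniteProjectiveDimension (ModuleCat.of (Env k A)ᵐᵒᵖ (Outer k X Y)) := by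
  have h1 : Module.Projective (Env k A)ᵐᵒᵖ (Outer k X Y) :=
    Module.Projective.of_equiv (Outer.regularEquiv u v).symm
  have h2 : Projective (ModuleCat.of (Env k A)ᵐᵒᵖ (Outer k X Y)) :=
    (IsProjective.iff_projective (R := (Env k A)ᵐᵒᵖ) _).1 h1
  exact ⟨1, inferInstance⟩

/-- Tensoring over a field is exact, so resolving `X` and then `Y` reduces to `A ⊗ A`, which is free
of rank one. -/
theorem hasFiniteProjectiveDimension_outer_of_resolutions {X : ModuleCat.{u} A}
    {Y : ModuleCat.{u} Aᵐᵒᵖ} (hX : HasFiniteResolution IsFinProj X)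
    (hY : HasFiniteResolution IsFinProj Y) :
    HasFiniteProjectiveDimension (ModuleCat.of (Env k A)ᵐᵒᵖ (Outer k X Y)) := by
  refine HasFiniteProjectiveDimension.of_hasFiniteResolution (outerLeft k Y)
    (outerLeft_shortExact Y) ?_ hX
  refine HasFiniteProjectiveDimension.of_hasFiniteResolution (outerRight k (regular A))
    (outerRight_shortExact _) ?_ hY
  exact hasFiniteProjectiveDimension_outer_of_equiv (LinearEquiv.refl A A)
    (LinearEquiv.refl Aᵐᵒᵖ Aᵐᵒᵖ)

theorem HasFiniteGlobalDimension.outer [Module.Finite k A] (hgl : HasFiniteGlobalDimension A)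
    (X Y : Type u)
    [AddCommGroup X] [iX : Module k X] [Module A X] [IsScalarTower k A X] [Module.Finite k X]
    [AddCommGroup Y] [iY : Module k Y] [Module Aᵐᵒᵖ Y] [IsScalarTower k Aᵐᵒᵖ Y]
    [Module.Finite k Y] :
    HasFiniteProjectiveDimension (ModuleCat.of (Env k A)ᵐᵒᵖ (Outer k X Y)) := by
  have hX := hgl.hasFiniteResolution_left k X
  have hY := hgl.hasFiniteResolution (k := k) (M := Y)
  obtain rfl := moduleOfAlgebraModule_of (k := k) (R := A) (M := X)
  obtain rfl := moduleOfAlgebraModule_of (k := k) (R := Aᵐᵒᵖ) (M := Y)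
  exact hasFiniteProjectiveDimension_outer_of_resolutions hX hY

variable (k) in
/-- The left action of `A` on a right module over the enveloping algebra. -/
def leftElt (a : A) : (Env k A)ᵐᵒᵖ := op (op a ⊗ₜ[k] 1)

variable (k) in
/-- The right action of `A` on a right module over the enveloping algebra. -/
def rightElt : Aᵐᵒᵖ →ₐ[k] (Env k A)ᵐᵒᵖ :=
  AlgHom.op (Algebra.TensorProduct.includeRight : A →ₐ[k] Env k A)

theorem rightElt_op (b : A) : rightElt k (op b) = op ((1 : Aᵐᵒᵖ) ⊗ₜ[k] b) := rfl

theorem leftElt_mul (a b : A) : leftElt k (a * b) = leftElt k a * leftElt k b := by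
  rw [leftElt, leftElt, leftElt, ← MulOpposite.op_mul, Algebra.TensorProduct.tmul_mul_tmul,
    one_mul, MulOpposite.op_mul]

theorem leftElt_one : leftElt k (1 : A) = 1 := rfl

theorem leftElt_add (a b : A) : leftElt k (a + b) = leftElt k a + leftElt k b := by
  simp only [leftElt, MulOpposite.op_add, TensorProduct.add_tmul]

theorem leftElt_smul (c : k) (a : A) : leftElt k (c • a) = c • leftElt k a := by
  rw [leftElt, MulOpposite.op_smul, ← TensorProduct.smul_tmul', MulOpposite.op_smul, leftElt]

variable (k) in
/-- `leftElt` as a linear map. -/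
def leftEltLinear : A →ₗ[k] (Env k A)ᵐᵒᵖ where
  toFun := leftElt k
  map_add' := leftElt_add
  map_smul' := leftElt_smul

theorem leftElt_sum {ι : Type*} (s : Finset ι) (f : ι → A) :
    leftElt k (∑ i ∈ s, f i) = ∑ i ∈ s, leftElt k (f i) := map_sum (leftEltLinear k) f s

theorem op_tmul_eq (a : Aᵐᵒᵖ) (b : A) :
    op (a ⊗ₜ[k] b : Env k A) = rightElt k (op b) * leftElt k (unop a) := by
  rw [rightElt_op, leftElt, ← MulOpposite.op_mul, Algebra.TensorProduct.tmul_mul_tmul, mul_one,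
    one_mul, op_unop]

theorem leftElt_mul_rightElt (a : A) (b : Aᵐᵒᵖ) :
    leftElt k a * rightElt k b = rightElt k b * leftElt k a := by
  rw [← op_unop b, rightElt_op, leftElt, ← MulOpposite.op_mul, ← MulOpposite.op_mul,
    Algebra.TensorProduct.tmul_mul_tmul, Algebra.TensorProduct.tmul_mul_tmul]
  simp only [one_mul, mul_one]

/-- The one dimensional left module of a character. -/
def LeftCharModule (_χ : A →ₐ[k] k) : Type u := k

namespace LeftCharModule

variable (χ : A →ₐ[k] k)

instance : AddCommGroup (LeftCharModule χ) := inferInstanceAs (AddCommGroup k)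
instance : Module k (LeftCharModule χ) := inferInstanceAs (Module k k)
instance : Module.Finite k (LeftCharModule χ) := inferInstanceAs (Module.Finite k k)
instance : Module A (LeftCharModule χ) := Module.compHom k χ.toRingHom
instance : IsScalarTower k A (LeftCharModule χ) where
  smul_assoc c a x := by
    change χ (c • a) * @id k x = c * (χ a * @id k x)
    rw [map_smul, smul_eq_mul, mul_assoc]

/-- The generator. -/
def gen : LeftCharModule χ := (1 : k)

theorem smul_gen (a : A) : a • gen χ = χ a • gen χ := rfl

/-- Coordinate in the one dimensional module. -/
def coord : LeftCharModule χ →ₗ[k] k := LinearMap.id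

theorem coord_smul (a : A) (x : LeftCharModule χ) : coord χ (a • x) = χ a * coord χ x := rfl

theorem coord_gen : coord χ (gen χ) = 1 := rfl

end LeftCharModule

namespace Splitting

variable {n : ℕ} {e : Fin n → A} (s : Splitting k e)
include s

theorem idem_mul_sub_mem (i : Fin n) (a : A) : e i * a - s.χ i a • e i ∈ s.J := by
  rw [s.mem_J]
  intro j
  rw [map_sub, map_mul, map_smul, s.χ_e]
  split_ifs with h
  · subst h; simp
  · simp

theorem mul_idem_sub_mem (i : Fin n) (a : A) : a * e i - s.χ i a • e i ∈ s.J := by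
  rw [s.mem_J]
  intro j
  rw [map_sub, map_mul, map_smul, s.χ_e]
  split_ifs with h
  · subst h; simp
  · simp

section

variable {M : Type u} [AddCommGroup M] [Module k M] [Module (Env k A)ᵐᵒᵖ M]
  [IsScalarTower k (Env k A)ᵐᵒᵖ M]

omit [Module k M] [IsScalarTower k (Env k A)ᵐᵒᵖ M] in
theorem leftElt_smul_eq (h : ∀ a ∈ s.J, ∀ x : M, leftElt k a • x = 0) {a b : A}
    (hab : a - b ∈ s.J) (x : M) : leftElt k a • x = leftElt k b • x := by
  have h1 := h _ hab x
  rw [← sub_add_cancel a b, leftElt_add, add_smul, h1, zero_add]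

/-- When `J` acts as zero on the left, `a` acts on `e_i M` by the scalar `χ_i(a)`. So `x ↦ 1 ⊗ e_i
x` and `c ⊗ y ↦ c e_i y` are bimodule maps to and from `S_i ⊗ M`. Their composites sum to `∑ e_i =
1`, making `M` a retract of the sum of the `S_i ⊗ M`. -/
theorem hasFiniteProjectiveDimension_of_killed [Module.Finite k A]
    (he : CompleteOrthogonalIdempotents e) (hgl : HasFiniteGlobalDimension A)
    [Module.Finite k M] (h : ∀ a ∈ s.J, ∀ x : M, leftElt k a • x = 0) :
    HasFiniteProjectiveDimension (ModuleCat.of (Env k A)ᵐᵒᵖ M) := by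
  let : Module Aᵐᵒᵖ M := Module.compHom M (rightElt k : Aᵐᵒᵖ →ₐ[k] _).toRingHom
  have hsm : ∀ (b : Aᵐᵒᵖ) (x : M), b • x = rightElt k b • x := fun _ _ => rfl
  have : IsScalarTower k Aᵐᵒᵖ M := ⟨fun c b x => by rw [hsm, hsm, map_smul, smul_assoc]⟩
  have hact : ∀ (i : Fin n) (a : Aᵐᵒᵖ) (b : A) (x : M),
      leftElt k (e i) • op (a ⊗ₜ[k] b : Env k A) • x =
        s.χ i (unop a) • rightElt k (op b) • leftElt k (e i) • x := by
    intro i a b x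
    rw [op_tmul_eq, ← mul_smul, ← mul_assoc, leftElt_mul_rightElt, mul_assoc, ← leftElt_mul,
      mul_smul, s.leftElt_smul_eq h (s.idem_mul_sub_mem i (unop a)), leftElt_smul, smul_assoc,
      smul_comm]
  have hact' : ∀ (i : Fin n) (a : Aᵐᵒᵖ) (b : A) (x : M),
      op (a ⊗ₜ[k] b : Env k A) • leftElt k (e i) • x =
        s.χ i (unop a) • leftElt k (e i) • rightElt k (op b) • x := by
    intro i a b x
    rw [op_tmul_eq, ← mul_smul, mul_assoc, ← leftElt_mul, mul_smul,
      s.leftElt_smul_eq h (s.mul_idem_sub_mem i (unop a)), leftElt_smul, smul_assoc,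
      smul_comm, ← mul_smul, ← leftElt_mul_rightElt, mul_smul]
  let f : ∀ i, M →ₗ[(Env k A)ᵐᵒᵖ] Outer k (LeftCharModule (s.χ i)) M := fun i =>
    envLinear
      { toFun := fun x => Outer.tmul (LeftCharModule.gen (s.χ i)) (leftElt k (e i) • x)
        map_zero' := by
          rw [smul_zero]
          exact TensorProduct.tmul_zero _ _
        map_add' := fun x y => by
          rw [smul_add]
          exact TensorProduct.tmul_add _ _ _ } fun a b x => by
      change Outer.tmul _ _ = op (a ⊗ₜ[k] b) • Outer.tmul _ _
      rw [Outer.smul_tmul, hact, LeftCharModule.smul_gen, hsm]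
      exact (TensorProduct.smul_tmul _ _ _).symm
  let g : ∀ i, Outer k (LeftCharModule (s.χ i)) M →ₗ[(Env k A)ᵐᵒᵖ] M := fun i =>
    Outer.lift (TensorProduct.lift
      (LinearMap.toSpanSingleton k (M →ₗ[k] M) (Algebra.lsmul k k M (leftElt k (e i))) ∘ₗ
          LeftCharModule.coord (s.χ i))) fun a b x y => by
      change (LeftCharModule.coord (s.χ i) (unop a • x)) • leftElt k (e i) • op b • y =
        op (a ⊗ₜ[k] b) • LeftCharModule.coord (s.χ i) x • leftElt k (e i) • y
      rw [LeftCharModule.coord_smul, smul_comm (op (a ⊗ₜ[k] b)), hact', hsm, mul_comm, mul_smul]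
  refine HasFiniteProjectiveDimension.of_sum_eq_id (fun i => ModuleCat.ofHom (f i))
    (fun i => ModuleCat.ofHom (g i)) ?_ fun i => hgl.outer (LeftCharModule (s.χ i)) M
  ext x
  simp only [ModuleCat.hom_sum, LinearMap.sum_apply]
  change ∑ i, LeftCharModule.coord (s.χ i) (LeftCharModule.gen (s.χ i)) •
    leftElt k (e i) • leftElt k (e i) • x = x
  simp only [LeftCharModule.coord_gen, one_smul, ← mul_smul, ← leftElt_mul, (he.idem _).eq]
  rw [← Finset.sum_smul, ← leftElt_sum, he.complete, leftElt_one, one_smul]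

/-- Induction on the power of `J` killing `M` on the left: the subbimodule `N = J M` is killed by
`J^m`, and `M / N` by `J`. -/
theorem hasFiniteProjectiveDimension_env [Module.Finite k A]
    (he : CompleteOrthogonalIdempotents e) (hgl : HasFiniteGlobalDimension A) (m : ℕ)
    (M : Type u) [AddCommGroup M] [Module k M] [Module (Env k A)ᵐᵒᵖ M]
    [IsScalarTower k (Env k A)ᵐᵒᵖ M] [Module.Finite k M]
    (h : ∀ a ∈ s.J ^ m, ∀ x : M, leftElt k a • x = 0) :
    HasFiniteProjectiveDimension (ModuleCat.of (Env k A)ᵐᵒᵖ M) := by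
  have htwo := s.twoSided
  induction m generalizing M with
  | zero =>
    have : Subsingleton M := by
      refine subsingleton_of_forall_eq 0 fun x => ?_
      have h1 := h 1 (by rw [Submodule.pow_zero, Ideal.one_eq_top]; trivial) x
      rwa [leftElt_one, one_smul] at h1
    exact ⟨0, (ModuleCat.isZero_of_subsingleton _).hasProjectiveDimensionLT_zero⟩
  | succ m ih =>
    -- Right actions commute past left ones, so only a left factor `c a' a` in `J^m J` remains.
    have hr : ∀ c ∈ s.J ^ m, ∀ r : (Env k A)ᵐᵒᵖ, ∀ a ∈ s.J, ∀ x : M,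
        leftElt k c • r • leftElt k a • x = 0 := by
      intro c hc r a ha x
      obtain ⟨r, rfl⟩ := op_surjective r
      induction r using TensorProduct.induction_on with
      | zero =>
        refine (congrArg (leftElt k c • ·) (zero_smul (Env k A)ᵐᵒᵖ (leftElt k a • x))).trans ?_
        exact smul_zero _
      | add r r' hr hr' => rw [MulOpposite.op_add, add_smul, smul_add, hr, hr', add_zero]
      | tmul a' b =>
        have key : leftElt k c * (rightElt k (op b) * leftElt k (unop a')) * leftElt k a =
            rightElt k (op b) * leftElt k (c * (unop a' * a)) := by
          rw [leftElt_mul, leftElt_mul, ← mul_assoc (leftElt k c), leftElt_mul_rightElt]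
          simp only [mul_assoc]
        rw [op_tmul_eq, ← mul_smul, ← mul_smul, key, mul_smul, h (c * (unop a' * a)), smul_zero]
        rw [Submodule.pow_succ]
        exact Ideal.mul_mem_mul hc (s.J.mul_mem_left _ ha)
    let N : Submodule (Env k A)ᵐᵒᵖ M := Submodule.span (Env k A)ᵐᵒᵖ
      {y | ∃ r : (Env k A)ᵐᵒᵖ, ∃ a ∈ s.J, ∃ x : M, y = r • leftElt k a • x}
    have hN : ∀ y ∈ N, ∀ a ∈ s.J ^ m, leftElt k a • y = 0 := by
      intro y hy
      refine Submodule.closure_induction (p := fun y _ => ∀ a ∈ s.J ^ m, leftElt k a • y = 0)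
        (fun c _ => smul_zero _) (fun y z _ _ hy hz c hc => ?_) (fun r y hy c hc => ?_) hy
      · exact (smul_add (leftElt k c) y z).trans (by rw [hy c hc, hz c hc, add_zero])
      · obtain ⟨r', a, ha, x, rfl⟩ := hy
        exact (congrArg (leftElt k c • ·) (mul_smul r r' (leftElt k a • x)).symm).trans
          (hr c hc (r * r') a ha x)
    have : Module.Finite k N := Module.Finite.of_injective (N.subtype.restrictScalars k)
      N.injective_subtype
    have : Module.Finite k (M ⧸ N) := Module.Finite.of_surjective (N.mkQ.restrictScalars k)
      N.mkQ_surjective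
    refine HasFiniteProjectiveDimension.of_submodule N (ih N fun a ha x => ?_) ?_
    · exact Subtype.ext (hN x x.2 a ha)
    · refine s.hasFiniteProjectiveDimension_of_killed (M := M ⧸ N) he hgl fun a ha x => ?_
      obtain ⟨x, rfl⟩ := N.mkQ_surjective x
      rw [← map_smul]
      exact (Submodule.Quotient.mk_eq_zero N).2 (Submodule.subset_span ⟨1, a, ha, x, (one_smul _ _).symm⟩)

/-- Since `J^r = 0`, the preceding induction applies to every finite-dimensional bimodule. -/
theorem hasFiniteResolution_env [Module.Finite k A] (he : CompleteOrthogonalIdempotents e)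
    (hgl : HasFiniteGlobalDimension A) [Module.Finite k M] :
    HasFiniteResolution IsFinProj (ModuleCat.of (Env k A)ᵐᵒᵖ M) := by
  obtain ⟨d, hd⟩ := s.hasFiniteProjectiveDimension_env he hgl s.r M fun a ha x => by
    rw [s.pow_eq] at ha
    rw [(Submodule.mem_bot A).1 ha]
    exact (congrArg (· • x) (map_zero (leftEltLinear k))).trans (zero_smul (Env k A)ᵐᵒᵖ x)
  have : IsNoetherianRing (Env k A)ᵐᵒᵖ := IsNoetherianRing.of_finite k _
  have : Module.Finite (Env k A)ᵐᵒᵖ M := Module.Finite.of_restrictScalars_finite k _ M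
  exact hasFiniteResolution_of_projectiveDimension d _
    (hasProjectiveDimensionLT_of_ge _ d _ (by omega))

end

end Splitting

end Outer

/-! ### Traces on pieces -/

section Pieces

variable {k : Type u} [Field k]

/-- The operator `p φ` has image in the range of `p` and agrees with `φ` there, so its trace is
computed on that range. -/
theorem trace_restrict_range {V : Type*} [AddCommGroup V] [Module k V] [Module.Finite k V]
    (p φ : V →ₗ[k] V) (hp : p ∘ₗ p = p)
    (h : ∀ x ∈ LinearMap.range p, φ x ∈ LinearMap.range p) :
    LinearMap.trace k (LinearMap.range p) (φ.restrict h) = LinearMap.trace k V (p ∘ₗ φ) := by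
  rw [← LinearMap.trace_restrict_eq_of_forall_mem (LinearMap.range p) (p ∘ₗ φ)
    (fun x => ⟨φ x, rfl⟩)]
  congr 1
  ext ⟨x, hx⟩
  obtain ⟨y, hy⟩ := h x hx
  change φ x = p (φ x)
  rw [← hy]
  exact (LinearMap.congr_fun hp y).symm

theorem trace_pieceEnd {R : Type u} [Ring R] [Algebra k R] {M : Type u} [AddCommGroup M]
    [Module k M] [Module R M] [IsScalarTower k R M] [Module.Finite k M] (φ : M →ₗ[R] M) {e : R}
    (he : IsIdempotentElem e) :
    LinearMap.trace k (piece k M e) (pieceEnd k φ e) = smulTrace k e φ :=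
  trace_restrict_range (Algebra.lsmul k k M e) (φ.restrictScalars k)
    (by ext x; simp [← mul_smul, he.eq]) _

variable {A : Type u} [Ring A] [Algebra k A]

section

variable {M : Type u} [AddCommGroup M] [Module k M] [Module A M] [Module Aᵐᵒᵖ M]
  [IsScalarTower k A M] [IsScalarTower k Aᵐᵒᵖ M] [SMulCommClass A Aᵐᵒᵖ M]

theorem biPiece_idem {f e : A} (hf : IsIdempotentElem f) (he : IsIdempotentElem e) :
    ((Algebra.lsmul k k M f : M →ₗ[k] M) ∘ₗ Algebra.lsmul k k M (op e)) ∘ₗ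
      ((Algebra.lsmul k k M f : M →ₗ[k] M) ∘ₗ Algebra.lsmul k k M (op e)) =
      (Algebra.lsmul k k M f : M →ₗ[k] M) ∘ₗ Algebra.lsmul k k M (op e) := by
  ext x
  simp only [LinearMap.comp_apply, Algebra.lsmul_coe]
  rw [← smul_comm f (op e), ← mul_smul f, hf.eq, ← mul_smul (op e), ← MulOpposite.op_mul, he.eq]

theorem trace_biPieceEnd [Module.Finite k M] (φ : BimodEnd k A M) {f e : A}
    (hf : IsIdempotentElem f) (he : IsIdempotentElem e) :
    LinearMap.trace k (biPiece k M f e) (biPieceEnd k φ f e) =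
      LinearMap.trace k M ((Algebra.lsmul k k M f : M →ₗ[k] M) ∘ₗ Algebra.lsmul k k M (op e) ∘ₗ
        φ.toLinearMap) :=
  trace_restrict_range _ φ.toLinearMap (biPiece_idem hf he) _

/-- The trace of an idempotent is its rank, read in `k`. -/
theorem finrank_biPiece [Module.Finite k M] {f e : A}
    (hf : IsIdempotentElem f) (he : IsIdempotentElem e) :
    (Module.finrank k (biPiece k M f e) : k) =
      LinearMap.trace k M ((Algebra.lsmul k k M f : M →ₗ[k] M) ∘ₗ Algebra.lsmul k k M (op e)) := by
  have h := trace_restrict_range _ LinearMap.id (biPiece_idem (k := k) (M := M) hf he)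
    (fun x hx => hx)
  rw [LinearMap.comp_id] at h
  rw [← h, ← LinearMap.trace_id]
  rfl

end

variable {n : ℕ} {e : Fin n → A} (he : CompleteOrthogonalIdempotents e) [Module.Finite k A]
include he

theorem cartanMatrix_cast (i j : Fin n) :
    (cartanMatrix k e i j : k) =
      LinearMap.trace k A (LinearMap.mulLeft k (e j) ∘ₗ LinearMap.mulRight k (e i)) := by
  rw [cartanMatrix, Matrix.of_apply, Int.cast_natCast, finrank_biPiece (he.idem j) (he.idem i)]
  rfl

theorem cartanMatrix_cast_op (i j : Fin n) :
    (cartanMatrix k e i j : k) = LinearMap.trace k Aᵐᵒᵖ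
      (LinearMap.mulLeft k (op (e i)) ∘ₗ LinearMap.mulRight k (op (e j))) := by
  rw [cartanMatrix_cast he, ← LinearMap.trace_conj' _ (opLinearEquiv k : A ≃ₗ[k] Aᵐᵒᵖ)]
  congr 1
  ext x
  obtain ⟨x, rfl⟩ := op_surjective x
  change op (e j * (x * e i)) = op (e i) * (op x * op (e j))
  simp only [← MulOpposite.op_mul, mul_assoc]

end Pieces

/-! ### Inverting the trace matrices; the Hochschild formulas -/

section LefschetzFormulas

variable {k A : Type u} [Field k] [Ring A] [Algebra k A] {n : ℕ} {e : Fin n → A}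

theorem invIn_mul {C : Matrix (Fin n) (Fin n) ℤ} (hC : IsUnit C) :
    invIn k C * C.map (Int.cast : ℤ → k) = 1 := by
  have h : C⁻¹ * C = 1 := Matrix.nonsing_inv_mul C ((Matrix.isUnit_iff_isUnit_det C).1 hC)
  have h2 := congrArg (fun D => D.map (Int.castRingHom k)) h
  simp only [Matrix.map_mul, Matrix.map_one, map_zero, map_one] at h2
  exact h2

theorem smulTrace_toSpanSingleton {R : Type u} [Ring R] [Algebra k R] (a b : R) :
    smulTrace k a (LinearMap.toSpanSingleton R R b) =
      LinearMap.trace k R (LinearMap.mulLeft k a ∘ₗ LinearMap.mulRight k b) := rfl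

namespace Splitting

variable (s : Splitting k e)
include s

theorem span_op_eq_top :
    ⊤ ≤ Submodule.span k (Set.range (fun i => op (e i)) ∪ {r : Aᵐᵒᵖ | IsNilpotent r}) := by
  intro a _
  have h := Submodule.mem_map_of_mem (f := (opLinearEquiv k : A ≃ₗ[k] Aᵐᵒᵖ).toLinearMap)
    (s.span_eq_top (Submodule.mem_top (x := unop a)))
  rw [Submodule.map_span] at h
  refine Submodule.span_mono ?_ h
  rintro _ ⟨x, ⟨i, rfl⟩ | ⟨m, hm⟩, rfl⟩
  · exact Or.inl ⟨i, rfl⟩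
  · refine Or.inr ⟨m, ?_⟩
    change (op x) ^ m = 0
    rw [← MulOpposite.op_pow, hm, MulOpposite.op_zero]

/-- Powers of a pure tensor are taken factor by factor, so a pure tensor with one nilpotent factor
is nilpotent; only the `e_i ⊗ e_j` remain. -/
theorem span_env_eq_top :
    ⊤ ≤ Submodule.span k (Set.range (fun p : Fin n × Fin n =>
      op (op (e p.1) ⊗ₜ[k] e p.2 : Env k A)) ∪ {r : (Env k A)ᵐᵒᵖ | IsNilpotent r}) := by
  let L : A →ₗ[k] A →ₗ[k] (Env k A)ᵐᵒᵖ :=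
    ((TensorProduct.mk k Aᵐᵒᵖ A).compr₂ (opLinearEquiv k : Env k A ≃ₗ[k] _).toLinearMap) ∘ₗ
      (opLinearEquiv k).toLinearMap
  have hL : ∀ a b, L a b = op (op a ⊗ₜ[k] b) := fun _ _ => rfl
  intro r _
  obtain ⟨r, rfl⟩ := op_surjective r
  induction r using TensorProduct.induction_on with
  | zero => exact Submodule.zero_mem _
  | add r r' hr hr' => exact Submodule.add_mem _ (hr trivial) (hr' trivial)
  | tmul a b =>
    have h := Submodule.apply_mem_map₂ L (s.span_eq_top (Submodule.mem_top (x := unop a)))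
      (s.span_eq_top (Submodule.mem_top (x := b)))
    rw [Submodule.map₂_span_span] at h
    refine Submodule.span_mono ?_ h
    rintro _ ⟨x, hx, y, hy, rfl⟩
    have hpow : ∀ m : ℕ, (L x y) ^ m = op (op (x ^ m) ⊗ₜ[k] (y ^ m)) := fun m => by
      rw [hL, ← MulOpposite.op_pow, Algebra.TensorProduct.tmul_pow, MulOpposite.op_pow]
    rcases hx with ⟨i, rfl⟩ | ⟨m, hm⟩
    · rcases hy with ⟨j, rfl⟩ | ⟨m, hm⟩
      · exact Or.inl ⟨(i, j), rfl⟩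
      · refine Or.inr ⟨m, ?_⟩
        rw [hpow, hm, TensorProduct.tmul_zero]
        rfl
    · refine Or.inr ⟨m, ?_⟩
      rw [hpow, hm, MulOpposite.op_zero, TensorProduct.zero_tmul]
      rfl

end Splitting

variable [Module.Finite k A]

theorem sum_invIn_smulTrace (he : CompleteOrthogonalIdempotents e)
    (hC : IsUnit (cartanMatrix k e)) (i p : Fin n) :
    ∑ j, invIn k (cartanMatrix k e) i j * smulTrace k (op (e j))
      (LinearMap.toSpanSingleton Aᵐᵒᵖ Aᵐᵒᵖ (op (e p))) = if i = p then 1 else 0 := by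
  simp only [smulTrace_toSpanSingleton, ← cartanMatrix_cast_op he]
  have h := congrFun (congrFun (invIn_mul (k := k) hC) i) p
  rw [Matrix.mul_apply, Matrix.one_apply] at h
  exact h

/-- The inverse of the matrix of traces on the enveloping algebra. -/
def envInv (D : Matrix (Fin n) (Fin n) k) : Matrix (Fin n × Fin n) (Fin n × Fin n) k :=
  Matrix.of fun p q => D q.1 p.1 * D p.2 q.2

/-- The two-sided multiplication on `Aᵐᵒᵖ ⊗ A` is a tensor product of two such operators, so its
trace is a product of two Cartan numbers. Their indices run in opposite orders because one factor is
`Aᵐᵒᵖ`. -/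
theorem smulTrace_env (he : CompleteOrthogonalIdempotents e) (q p : Fin n × Fin n) :
    smulTrace k (op (op (e q.1) ⊗ₜ[k] e q.2 : Env k A))
      (LinearMap.toSpanSingleton (Env k A)ᵐᵒᵖ (Env k A)ᵐᵒᵖ (op (op (e p.1) ⊗ₜ[k] e p.2))) =
      (cartanMatrix k e p.1 q.1 : k) * cartanMatrix k e q.2 p.2 := by
  rw [smulTrace_toSpanSingleton, cartanMatrix_cast_op he, cartanMatrix_cast he,
    ← LinearMap.trace_tensorProduct',
    ← LinearMap.trace_conj' _ (opLinearEquiv k : Env k A ≃ₗ[k] _).symm]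
  congr 1
  apply TensorProduct.ext'
  intro x y
  change ((op (e p.1) ⊗ₜ[k] e p.2 : Env k A) * (op (op (x ⊗ₜ[k] y))).unop.unop) *
    (op (e q.1) ⊗ₜ[k] e q.2) = _
  change ((op (e p.1) ⊗ₜ[k] e p.2 : Env k A) * (x ⊗ₜ[k] y)) * (op (e q.1) ⊗ₜ[k] e q.2) =
    (op (e p.1) * (x * op (e q.1))) ⊗ₜ[k] (e p.2 * (y * e q.2))
  rw [Algebra.TensorProduct.tmul_mul_tmul, Algebra.TensorProduct.tmul_mul_tmul, mul_assoc,
    mul_assoc]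

/-- The trace matrix is a Kronecker product of the Cartan matrix and its transpose, inverted factor
by factor. -/
theorem sum_envInv_smulTrace (he : CompleteOrthogonalIdempotents e)
    (hC : IsUnit (cartanMatrix k e)) (i p : Fin n × Fin n) :
    ∑ j : Fin n × Fin n, envInv (invIn k (cartanMatrix k e)) i j *
      smulTrace k (op (op (e j.1) ⊗ₜ[k] e j.2 : Env k A))
      (LinearMap.toSpanSingleton (Env k A)ᵐᵒᵖ (Env k A)ᵐᵒᵖ (op (op (e p.1) ⊗ₜ[k] e p.2))) =
      if i = p then 1 else 0 := by
  have h := invIn_mul (k := k) hC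
  have h' := mul_eq_one_comm.1 h
  have h1 := congrFun (congrFun h' p.1) i.1
  have h2 := congrFun (congrFun h i.2) p.2
  rw [Matrix.mul_apply, Matrix.one_apply] at h1 h2
  simp only [smulTrace_env he, envInv, Matrix.of_apply, Fintype.sum_prod_type]
  have h3 := congrArg₂ (· * ·) h1 h2
  simp only [Finset.sum_mul_sum, Matrix.map_apply] at h3
  calc _ = _ := Finset.sum_congr rfl fun a _ => Finset.sum_congr rfl fun b _ => by ring
    _ = _ := h3
    _ = _ := by
      rw [ite_zero_mul_ite_zero, mul_one]
      exact if_congr (by rw [Prod.ext_iff, eq_comm (a := p.1)]) rfl rfl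

/-- Here `C j.2 j.1` is the trace vector of the identity of the bimodule `A`; summing over `j.2`
cancels it against one of the two copies of `D = C⁻¹`. -/
theorem sum_envInv_trace {D C : Matrix (Fin n) (Fin n) k} (h : D * C = 1)
    (v : Fin n × Fin n → k) :
    ∑ i, ∑ j : Fin n × Fin n, v i * envInv D i j * C j.2 j.1 = ∑ i, v i * D i.2 i.1 := by
  refine Finset.sum_congr rfl fun i _ => ?_
  simp only [envInv, Matrix.of_apply, Fintype.sum_prod_type]
  have h1 : ∀ a, ∑ b, D i.2 b * C b a = (1 : Matrix (Fin n) (Fin n) k) i.2 a := fun a => by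
    rw [← h, Matrix.mul_apply]
  calc _ = ∑ a, v i * D a i.1 * ∑ b, D i.2 b * C b a :=
        Finset.sum_congr rfl fun a _ => by
          rw [Finset.mul_sum]
          exact Finset.sum_congr rfl fun b _ => by ring
    _ = _ := by simp [h1, Matrix.one_apply]

section Bimodules

variable {M : Type u} [AddCommGroup M] [Module k M] [Module A M] [Module Aᵐᵒᵖ M]
  [IsScalarTower k A M] [IsScalarTower k Aᵐᵒᵖ M] [SMulCommClass A Aᵐᵒᵖ M]

variable (k A M) in
/-- The right module over the enveloping algebra underlying `bimodRight`. -/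
abbrev rightEnvModule : Module (Env k A)ᵐᵒᵖ M :=
  Module.compHom M (rightEnvHom k A M).toRingHom

variable (k A M) in
/-- The left module over the enveloping algebra underlying `bimodLeft`. -/
abbrev leftEnvModule : Module (Env k A) M :=
  Module.compHom M (leftEnvHom k A M).toRingHom

omit [Module.Finite k A] in
theorem rightEnv_isScalarTower :
    letI := rightEnvModule k A M
    IsScalarTower k (Env k A)ᵐᵒᵖ M :=
  letI := rightEnvModule k A M
  ⟨fun c r x => by
    change rightEnvHom k A M (c • r) x = c • rightEnvHom k A M r x
    rw [map_smul, LinearMap.smul_apply]⟩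

omit [Module.Finite k A] in
theorem leftEnv_isScalarTower :
    letI := leftEnvModule k A M
    IsScalarTower k (Env k A) M :=
  letI := leftEnvModule k A M
  ⟨fun c r x => by
    change leftEnvHom k A M (c • r) x = c • leftEnvHom k A M r x
    rw [map_smul, LinearMap.smul_apply]⟩

variable [Module.Finite k M] (φ : BimodEnd k A M) (s : Splitting k e)
  (he : CompleteOrthogonalIdempotents e) (hC : IsUnit (cartanMatrix k e))
  (hgl : HasFiniteGlobalDimension A)
include s he hC hgl

/-- As a right module over the enveloping algebra, `M` contributes the trace on `e_{i.1} M e_{i.2}`,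
the entry `(i.2, i.1)`. Its indices agree with those of the remaining `C⁻¹`, which produces the
transpose. -/
theorem hasSuperTrace_hochschildCohomology :
    HasSuperTrace (hochschildCohomologyEnd φ)
      (Matrix.trace ((invIn k (cartanMatrix k e))ᵀ * traceMatrix k e φ)) := by
  let := rightEnvModule k A A
  let := rightEnvModule k A M
  have := rightEnv_isScalarTower (k := k) (A := A) (M := A)
  have := rightEnv_isScalarTower (k := k) (A := A) (M := M)
  let ψ : M →ₗ[(Env k A)ᵐᵒᵖ] M := φ.right.hom
  have h := hasSuperTrace_ext s.span_env_eq_top _ (sum_envInv_smulTrace he hC)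
    (s.hasFiniteResolution_env (M := A) he hgl) LinearMap.id ψ
  have h1 : ∀ i : Fin n × Fin n, smulTrace k (op (op (e i.1) ⊗ₜ[k] e i.2 : Env k A))
      (LinearMap.id : A →ₗ[(Env k A)ᵐᵒᵖ] A) =
        (cartanMatrix k e).map (Int.cast : ℤ → k) i.2 i.1 := fun i => by
    rw [Matrix.map_apply, cartanMatrix_cast he]
    refine congrArg (LinearMap.trace k A) (LinearMap.ext fun x => ?_)
    refine (rightEnvHom_tmul k A A (op (e i.1)) (e i.2) x).trans ?_
    exact mul_assoc _ _ _
  have h2 : ∀ i : Fin n × Fin n, smulTrace k (op (op (e i.1) ⊗ₜ[k] e i.2 : Env k A)) ψ =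
      traceMatrix k e φ i.2 i.1 := fun i => by
    rw [traceMatrix, Matrix.of_apply, trace_biPieceEnd φ (he.idem _) (he.idem _)]
    refine congrArg (LinearMap.trace k M) (LinearMap.ext fun x => ?_)
    refine (rightEnvHom_tmul k A M (op (e i.1)) (e i.2) (φ.toLinearMap x)).trans ?_
    exact (smul_comm _ _ _).symm
  simp only [h1, h2] at h
  rw [sum_envInv_trace (invIn_mul hC) (fun i => traceMatrix k e φ i.2 i.1)] at h
  -- Only the value of the super trace has to be rewritten; the operators agree definitionally.
  refine cast (congrArg _ ?_) h
  simp only [Matrix.trace, Matrix.diag_apply, Matrix.mul_apply, Matrix.transpose_apply,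
    Fintype.sum_prod_type]
  exact Finset.sum_congr rfl fun a _ => Finset.sum_congr rfl fun b _ => mul_comm _ _

/-- Now `M` is a left module over the enveloping algebra, so `e_{i.1} ⊗ e_{i.2}` cuts out `e_{i.2} M
e_{i.1}`, the entry `(i.1, i.2)`, and no transpose appears. -/
theorem hasSuperTrace_hochschildHomology :
    HasSuperTrace (hochschildHomologyEnd φ)
      (Matrix.trace (invIn k (cartanMatrix k e) * traceMatrix k e φ)) := by
  let := rightEnvModule k A A
  let := leftEnvModule k A M
  have := rightEnv_isScalarTower (k := k) (A := A) (M := A)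
  have := leftEnv_isScalarTower (k := k) (A := A) (M := M)
  let ψ : M →ₗ[Env k A] M := φ.left.hom
  have h := hasSuperTrace_tor s.span_env_eq_top _ (sum_envInv_smulTrace he hC)
    (s.hasFiniteResolution_env (M := A) he hgl) LinearMap.id ψ
  have h1 : ∀ i : Fin n × Fin n, smulTrace k (op (op (e i.1) ⊗ₜ[k] e i.2 : Env k A))
      (LinearMap.id : A →ₗ[(Env k A)ᵐᵒᵖ] A) =
        (cartanMatrix k e).map (Int.cast : ℤ → k) i.2 i.1 := fun i => by
    rw [Matrix.map_apply, cartanMatrix_cast he]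
    refine congrArg (LinearMap.trace k A) (LinearMap.ext fun x => ?_)
    refine (rightEnvHom_tmul k A A (op (e i.1)) (e i.2) x).trans ?_
    exact mul_assoc _ _ _
  have h2 : ∀ i : Fin n × Fin n, smulTrace k (op (e i.1) ⊗ₜ[k] e i.2 : Env k A) ψ =
      traceMatrix k e φ i.1 i.2 := fun i => by
    rw [traceMatrix, Matrix.of_apply, trace_biPieceEnd φ (he.idem _) (he.idem _)]
    refine congrArg (LinearMap.trace k M) (LinearMap.ext fun x => ?_)
    refine (leftEnvHom_tmul k A M (op (e i.1)) (e i.2) (φ.toLinearMap x)).trans ?_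
    exact (smul_comm _ _ _).symm
  simp only [h1, h2, unop_op] at h
  rw [sum_envInv_trace (invIn_mul hC) (fun i => traceMatrix k e φ i.1 i.2)] at h
  refine cast (congrArg _ ?_) h
  simp only [Matrix.trace, Matrix.diag_apply, Matrix.mul_apply, Fintype.sum_prod_type]
  rw [Finset.sum_comm]
  exact Finset.sum_congr rfl fun a _ => Finset.sum_congr rfl fun b _ => mul_comm _ _

end Bimodules

end LefschetzFormulas

end Lefschetz

end

/-! ### The four Lefschetz formulas -/

theorem theorem6 {k A : Type u} [Field k] [Ring A] [Algebra k A] [FiniteDimensional k A]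
    (hA : Lefschetz.IsElementary k A) (hgl : Lefschetz.HasFiniteGlobalDimension A)
    {n : ℕ} (e : Fin n → A) (he : Lefschetz.IsCompletePrimitive e) :
    -- the Cartan matrix is invertible over the integers
    IsUnit (Lefschetz.cartanMatrix k e) ∧
    -- (1) Ext
    (∀ (M N : Type u) [AddCommGroup M] [Module k M] [Module Aᵐᵒᵖ M] [IsScalarTower k Aᵐᵒᵖ M]
      [FiniteDimensional k M] [AddCommGroup N] [Module k N] [Module Aᵐᵒᵖ N]
      [IsScalarTower k Aᵐᵒᵖ N] [FiniteDimensional k N]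
      (φ : M →ₗ[Aᵐᵒᵖ] M) (ψ : N →ₗ[Aᵐᵒᵖ] N),
      Lefschetz.HasSuperTrace
        (fun l => Lefschetz.extEnd k l (ModuleCat.ofHom φ) (ModuleCat.ofHom ψ))
        (Lefschetz.tvRight k e φ ⬝ᵥ
          ((Lefschetz.invIn k (Lefschetz.cartanMatrix k e))ᵀ *ᵥ Lefschetz.tvRight k e ψ))) ∧
    -- (2) Tor
    (∀ (M N : Type u) [AddCommGroup M] [Module k M] [Module Aᵐᵒᵖ M] [IsScalarTower k Aᵐᵒᵖ M]
      [FiniteDimensional k M] [AddCommGroup N] [Module k N] [Module A N]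
      [IsScalarTower k A N] [FiniteDimensional k N]
      (φ : M →ₗ[Aᵐᵒᵖ] M) (ψ : N →ₗ[A] N),
      Lefschetz.HasSuperTrace
        (fun l => Lefschetz.torEnd k l (ModuleCat.ofHom φ) (ModuleCat.ofHom ψ))
        (Lefschetz.tvLeft k e ψ ⬝ᵥ
          (Lefschetz.invIn k (Lefschetz.cartanMatrix k e) *ᵥ Lefschetz.tvRight k e φ))) ∧
    -- (3) Hochschild cohomology
    (∀ (M : Type u) [AddCommGroup M] [Module k M] [Module A M] [Module Aᵐᵒᵖ M]
      [IsScalarTower k A M] [IsScalarTower k Aᵐᵒᵖ M] [SMulCommClass A Aᵐᵒᵖ M]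
      [FiniteDimensional k M] (φ : Lefschetz.BimodEnd k A M),
      Lefschetz.HasSuperTrace (Lefschetz.hochschildCohomologyEnd φ)
        (Matrix.trace ((Lefschetz.invIn k (Lefschetz.cartanMatrix k e))ᵀ *
          Lefschetz.traceMatrix k e φ))) ∧
    -- (4) Hochschild homology
    (∀ (M : Type u) [AddCommGroup M] [Module k M] [Module A M] [Module Aᵐᵒᵖ M]
      [IsScalarTower k A M] [IsScalarTower k Aᵐᵒᵖ M] [SMulCommClass A Aᵐᵒᵖ M]
      [FiniteDimensional k M] (φ : Lefschetz.BimodEnd k A M),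
      Lefschetz.HasSuperTrace (Lefschetz.hochschildHomologyEnd φ)
        (Matrix.trace (Lefschetz.invIn k (Lefschetz.cartanMatrix k e) *
          Lefschetz.traceMatrix k e φ))) := by
  obtain ⟨s⟩ := Lefschetz.exists_splitting hA he
  have hC := s.isUnit_cartanMatrix he.complete hgl
  have hT := Lefschetz.sum_invIn_smulTrace he.complete hC
  -- The trace on `M e_i` equals the trace on all of `M` of `φ` followed by `e_i`, the form used by
  -- the general formula.
  have htv : ∀ (M : Type u) [AddCommGroup M] [Module k M] [Module Aᵐᵒᵖ M]
      [IsScalarTower k Aᵐᵒᵖ M] [FiniteDimensional k M] (φ : M →ₗ[Aᵐᵒᵖ] M),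
      Lefschetz.tvRight k e φ = fun i => Lefschetz.smulTrace k (MulOpposite.op (e i)) φ := by
    intro M _ _ _ _ _ φ
    ext i
    exact Lefschetz.trace_pieceEnd φ
      (by rw [IsIdempotentElem, ← MulOpposite.op_mul, (he.complete.idem i).eq])
  refine ⟨hC, ?_, ?_, ?_, ?_⟩
  · intro M N _ _ _ _ _ _ _ _ _ _ φ ψ
    convert Lefschetz.hasSuperTrace_ext s.span_op_eq_top _ hT (hgl.hasFiniteResolution (k := k)) φ ψ
    rw [htv, htv]
    simp only [dotProduct, Matrix.mulVec, Matrix.transpose_apply, Finset.mul_sum]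
    rw [Finset.sum_comm]
    exact Finset.sum_congr rfl fun i _ => Finset.sum_congr rfl fun j _ => by ring
  · intro M N _ _ _ _ _ _ _ _ _ _ φ ψ
    convert Lefschetz.hasSuperTrace_tor s.span_op_eq_top _ hT (hgl.hasFiniteResolution (k := k)) φ ψ
    have htv' : Lefschetz.tvLeft k e ψ = fun i => Lefschetz.smulTrace k (e i) ψ := by
      ext i
      exact Lefschetz.trace_pieceEnd ψ (he.complete.idem i)
    rw [htv, htv']
    simp only [dotProduct, Matrix.mulVec, Finset.mul_sum, mul_assoc, MulOpposite.unop_op]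
  · intro M _ _ _ _ _ _ _ _ φ
    exact Lefschetz.hasSuperTrace_hochschildCohomology φ s he.complete hC hgl
  · intro M _ _ _ _ _ _ _ _ φ
    exact Lefschetz.hasSuperTrace_hochschildHomology φ s he.complete hC hgl
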